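/- Let a group $G$ act by isometries on two geodesic metric spaces $(X_1,d_1)$ and $(X_2,d_2)$, fix basepoints $o_i\in X_i$, and suppose that both actions have contracting property. Let $\mathcal{SC}(G)$ be the set of elements of $G$ that are contracting for both actions, and for $i=1,2$ let $\ell_{d_i}(g)=\lim_{n\to\infty} d_i(o_i,g^no_i)/n$ be the stable translation length. Then there exist $\varepsilon>0$ and a set $S\subseteq\mathcal{SC}(G)$ of at most $15$ elements such that for every $g\in G$ there is $f\in S$ with 1. $\ell_{d_i}(gf)\ge d_i(o_i,gfo_i)-2\varepsilon$ for $i=1,2$; 2. $gf\in\mathcal{SC}(G)$ and $fg\in\mathcal{SC}(G)$. Here the following definitions are used, for a group $G$ acting by isometries on a geodesic metric space $(X,d)$ with basepoint $o$. For $A\subseteq X$ and $x\in X$, the projection $\pi_A(x)$ is $\{y\in\overline A : d(x,y)=d(x,A)\}$ if $X$ is proper, and $\{y\in A : d(x,y)\le d(x,A)+1\}$ if $X$ is not proper; $\pi_A(B)=\bigcup_{x\in B}\pi_A(x)$. A subset $Y\subseteq X$ is contracting if there is $C\ge 0$ such that $\operatorname{diam}\pi_Y(\alpha)\le C$ for every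 geodesic segment $\alpha$ with $d(\alpha,Y)\ge C$. An element $h\in G$ is contracting if $\langle h\rangle o$ is a contracting subset and $n\mapsto h^no$ is a quasi-isometric embedding $\mathbb Z\to X$. Two contracting elements $g,h$ are weakly independent if there is a function $\mathcal R:[0,\infty)\to[0,\infty)$ such that $\operatorname{diam}\big(N_r(\langle g\rangle o)\cap N_r(\langle h\rangle o)\big)\le\mathcal R(r)$ for all $r\ge 0$, where $N_r(A)=\{x : d(x,A)\le r\}$. The action has contracting property if there are two weakly independent contracting elements in $G$. -/

import Mathlib

open Filter Topology
open scoped NNReal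

/-- `α : [0, L] → X` is a geodesic segment of length `L`. (The values of `α` outside `[0, L]` are
irrelevant.) -/
def IsGeodesicSegment {X : Type*} [MetricSpace X] (α : ℝ → X) (L : ℝ) : Prop :=
  0 ≤ L ∧ ∀ s ∈ Set.Icc (0 : ℝ) L, ∀ t ∈ Set.Icc (0 : ℝ) L, dist (α s) (α t) = |s - t|

/-- A metric space is geodesic if any two points are the endpoints of a geodesic segment. -/
def IsGeodesicSpace (X : Type*) [MetricSpace X] : Prop :=
  ∀ x y : X, ∃ (L : ℝ) (α : ℝ → X), IsGeodesicSegment α L ∧ α 0 = x ∧ α L = y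

/-- The points of the closure of `A` that realise the distance from `x` to `A`. -/
def nearestPoints {X : Type*} [MetricSpace X] (A : Set X) (x : X) : Set X :=
  {y | y ∈ closure A ∧ dist x y = Metric.infDist x A}

/-- The points of `A` that realise the distance from `x` to `A` up to an additive error `1`. -/
def coarselyNearestPoints {X : Type*} [MetricSpace X] (A : Set X) (x : X) : Set X :=
  {y | y ∈ A ∧ dist x y ≤ Metric.infDist x A + 1}

/-- The (set-valued) closest point projection `π_A(x)`. In a proper space it consists of the nearest
points; in a space that is not proper, where nearest points need not exist, it consists of the
coarsely nearest points. -/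
def closestProj {X : Type*} [MetricSpace X] (A : Set X) (x : X) : Set X :=
  {y | (ProperSpace X ∧ y ∈ nearestPoints A x) ∨
    (¬ ProperSpace X ∧ y ∈ coarselyNearestPoints A x)}

/-- `π_A(B)`, the union of the projections of the points of `B`. -/
def closestProjSet {X : Type*} [MetricSpace X] (A B : Set X) : Set X :=
  ⋃ x ∈ B, closestProj A x

/-- The diameter of `A` is at most `C`. (Used with `0 ≤ C` only; `Metric.diam` is avoided since it
vanishes on unbounded sets.) -/
def DiamLE {X : Type*} [MetricSpace X] (A : Set X) (C : ℝ) : Prop :=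
  ∀ x ∈ A, ∀ y ∈ A, dist x y ≤ C

/-- `Y` is `C`-contracting: every geodesic segment `α` with `d(α, Y) ≥ C` satisfies
`diam (π_Y(α)) ≤ C`. -/
def IsContractingWith {X : Type*} [MetricSpace X] (C : ℝ) (Y : Set X) : Prop :=
  ∀ (L : ℝ) (α : ℝ → X), IsGeodesicSegment α L →
    (∀ t ∈ Set.Icc (0 : ℝ) L, C ≤ Metric.infDist (α t) Y) →
    DiamLE (closestProjSet Y (α '' Set.Icc (0 : ℝ) L)) C

/-- `Y` is a contracting subset. -/
def IsContractingSet {X : Type*} [MetricSpace X] (Y : Set X) : Prop :=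
  ∃ C : ℝ, 0 ≤ C ∧ IsContractingWith C Y

/-- `Y` and `Z` have `R`-bounded intersection: the closed `r`-neighbourhoods of `Y` and `Z` meet in
a set of diameter at most `R r`, for all `r ≥ 0`. -/
def HasBoundedIntersection {X : Type*} [MetricSpace X] (R : ℝ≥0 → ℝ≥0) (Y Z : Set X) : Prop :=
  ∀ r : ℝ≥0, DiamLE (Metric.cthickening (r : ℝ) Y ∩ Metric.cthickening (r : ℝ) Z) (R r)

/-- `u : ℤ → X` is a quasi-isometric embedding. -/
def IsQuasiIsometricEmbeddingInt {X : Type*} [MetricSpace X] (u : ℤ → X) : Prop :=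
  ∃ k c : ℝ, 1 ≤ k ∧ 0 ≤ c ∧ ∀ m n : ℤ,
    1 / k * |(m : ℝ) - (n : ℝ)| - c ≤ dist (u m) (u n) ∧
      dist (u m) (u n) ≤ k * |(m : ℝ) - (n : ℝ)| + c

/-- The orbit `⟨h⟩ • o` of the cyclic subgroup generated by `h`. -/
def cyclicOrbit {G : Type*} [Group G] {X : Type*} [MulAction G X] (o : X) (h : G) : Set X :=
  Set.range fun n : ℤ => h ^ n • o

/-- `h` is a contracting element, tested at the basepoint `o`. -/
def IsContractingElement {G : Type*} [Group G] {X : Type*} [MetricSpace X] [MulAction G X]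
    (o : X) (h : G) : Prop :=
  IsContractingSet (cyclicOrbit o h) ∧ IsQuasiIsometricEmbeddingInt fun n : ℤ => h ^ n • o

/-- The orbits of `g` and `h` have bounded intersection. -/
def WeaklyIndependent {G : Type*} [Group G] {X : Type*} [MetricSpace X] [MulAction G X]
    (o : X) (g h : G) : Prop :=
  ∃ R : ℝ≥0 → ℝ≥0, HasBoundedIntersection R (cyclicOrbit o g) (cyclicOrbit o h)

/-- The action of `G` has contracting property: there are two weakly independent contracting
elements. -/
def HasContractingProperty (G : Type*) [Group G] {X : Type*} [MetricSpace X] [MulAction G X]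
    (o : X) : Prop :=
  ∃ g h : G, IsContractingElement o g ∧ IsContractingElement o h ∧ WeaklyIndependent o g h

/-- The set of simultaneously contracting elements of two actions of `G`. -/
def simultaneouslyContracting (G : Type*) [Group G] {X₁ X₂ : Type*} [MetricSpace X₁]
    [MetricSpace X₂] [MulAction G X₁] [MulAction G X₂] (o₁ : X₁) (o₂ : X₂) : Set G :=
  {g | IsContractingElement o₁ g ∧ IsContractingElement o₂ g}

/-- The stable translation length `lim_{n → ∞} d(o, gⁿ o) / n`. The limit exists for isometric
actions, see `tendsto_stableLength`. -/
noncomputable def stableLength {G : Type*} [Group G] {X : Type*} [MetricSpace X] [MulAction G X]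
    (o : X) (g : G) : ℝ :=
  limUnder atTop fun n : ℕ => dist o (g ^ n • o) / (n : ℝ)

/-- The limit defining the stable translation length exists. -/
theorem tendsto_stableLength {G : Type*} [Group G] {X : Type*} [MetricSpace X] [MulAction G X]
    [IsIsometricSMul G X] (o : X) (g : G) :
    Tendsto (fun n : ℕ => dist o (g ^ n • o) / (n : ℝ)) atTop (𝓝 (stableLength o g)) := by
  have h : Subadditive fun n : ℕ => dist o (g ^ n • o) := by
    intro m n
    calc dist o (g ^ (m + n) • o)
        ≤ dist o (g ^ m • o) + dist (g ^ m • o) (g ^ (m + n) • o) := dist_triangle _ _ _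
      _ = dist o (g ^ m • o) + dist o (g ^ n • o) := by
          rw [pow_add, mul_smul, dist_smul]
  refine tendsto_nhds_limUnder ⟨h.lim, h.tendsto_lim ⟨0, ?_⟩⟩
  rintro _ ⟨n, rfl⟩
  positivity

/-! Contraction is used only through `CtrWith`: if two points have distant projections to `Y`, the
path through the projections is almost as short as possible. This implies the Behrstock inequality:
for two axes with bounded mutual projections, no point projects far from `o` on both. So in a family
of pairwise independent axes, each point is bad (projects far from `o`) for at most one member.

Let `b` preserve a contracting set `Y`, and let `b` and `t` move `o` far. If `t o` and `t⁻¹ o`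
project to `Y` near `o`, then `t * b` plays ping-pong (`isPingPong_mul`). Hence its orbit is almost
aligned, it is contracting, and its stable length is its displacement up to a constant.

Suppose `c 0`, ..., `c 5` have axes independent in both spaces and move both basepoints far. Given
`g`, take `f = c 0 ^ k * c j` and `t = g * c 0 ^ k`. In each space at most one `k` in {1, 2, 3}
leaves `t` with small displacement, so some `k` serves both. The points `t o₁`, `t⁻¹ o₁`, `t o₂`,
`t⁻¹ o₂` rule out at most four of the five other axes, so some `j` works. This uses 3 · 5 = 15
elements, and `f * g` is conjugate to `g * f`.

A priori no element is contracting for both actions. One is built as a product of a contracting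
element of each action and a spacer, chosen by counting bad pairs (`FailsAtMost.exists_pair`);
suitable conjugates of it give the common axes (`exists_common_axes`). -/

open scoped Pointwise

/-! ### Contracting sets and projections, without geodesics. -/

section Projections

variable {X : Type*} [MetricSpace X]

/-- `p` is a nearest point of `Y` to `x`, up to an additive error `1`. -/
def IsProj (Y : Set X) (x p : X) : Prop := p ∈ Y ∧ ∀ y ∈ Y, dist x p ≤ dist x y + 1

/-- If the projections `p`, `q` of `x`, `y` to `Y` are far apart, then the path from `x` to `y`
through `p` and `q` is almost as short as possible. -/
def CtrWith (K : ℝ) (Y : Set X) : Prop :=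
  ∀ ⦃x y p q : X⦄, IsProj Y x p → IsProj Y y q → K < dist p q →
    dist x p + dist p q + dist q y ≤ dist x y + K

/-- All projections of `x` to `Y` lie within distance `B` of `c`. -/
def ProjWithin (Y : Set X) (c : X) (B : ℝ) (x : X) : Prop := ∀ p, IsProj Y x p → dist c p ≤ B

/-- The projection of `Z` to `Y` is bounded. -/
def BddProj (Y Z : Set X) : Prop :=
  ∃ B : ℝ, ∀ z ∈ Z, ∀ z' ∈ Z, ∀ p p', IsProj Y z p → IsProj Y z' p' → dist p p' ≤ B

theorem IsProj.exists {Y : Set X} (hY : Y.Nonempty) (x : X) : ∃ p, IsProj Y x p := by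
  obtain ⟨p, hp, h⟩ := (Metric.infDist_lt_iff hY (x := x) (r := Metric.infDist x Y + 1)).1
    (by linarith)
  exact ⟨p, hp, fun y hy => by linarith [Metric.infDist_le_dist_of_mem (x := x) hy]⟩

theorem IsProj.self {Y : Set X} {y : X} (hy : y ∈ Y) : IsProj Y y y :=
  ⟨hy, fun z _ => by linarith [dist_self y, dist_nonneg (x := y) (y := z)]⟩

theorem CtrWith.mono {K K' : ℝ} {Y : Set X} (h : CtrWith K Y) (hK : K ≤ K') : CtrWith K' Y :=
  fun _ _ _ _ hp hq hd => by linarith [h hp hq (by linarith)]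

theorem CtrWith.dist_le {K : ℝ} {Y : Set X} (h : CtrWith K Y) {x p q : X}
    (hp : IsProj Y x p) (hq : IsProj Y x q) : dist p q ≤ K := by
  by_contra! hd
  have := h hp hq hd
  linarith [dist_self x, dist_nonneg (x := x) (y := p), dist_nonneg (x := q) (y := x)]

theorem CtrWith.nonneg {K : ℝ} {Y : Set X} (h : CtrWith K Y) (hY : Y.Nonempty) : 0 ≤ K := by
  obtain ⟨y, hy⟩ := hY
  simpa using h.dist_le (IsProj.self hy) (IsProj.self hy)

theorem ProjWithin.mono {Y : Set X} {c x : X} {B B' : ℝ} (h : ProjWithin Y c B x)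
    (hB : B ≤ B') : ProjWithin Y c B' x := fun p hp => (h p hp).trans hB

/-- A set is contracting as soon as some coarse retraction onto it behaves like a projection. -/
theorem ctrWith_of_map {K : ℝ} (hK : 0 ≤ K) {Y : Set X} (P : X → X)
    (h1 : ∀ x, ∃ y ∈ Y, dist (P x) y ≤ K) (h2 : ∀ y ∈ Y, dist y (P y) ≤ K)
    (h3 : ∀ x y, K < dist (P x) (P y) →
      dist x (P x) + dist (P x) (P y) + dist (P y) y ≤ dist x y + K) :
    CtrWith (9 * K + 4) Y := by
  -- `P` agrees with closest point projection up to `2 * K + 1`; replacing it four times below turns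
  -- `K` into `9 * K + 4`.
  have key : ∀ x p, IsProj Y x p → dist p (P x) ≤ 2 * K + 1 := by
    intro x p hp
    have hp2 := h2 p hp.1
    rcases le_or_gt (dist (P x) (P p)) K with hd | hd
    · linarith [dist_triangle p (P p) (P x), dist_comm (P x) (P p)]
    · obtain ⟨y, hy, hyd⟩ := h1 x
      linarith [h3 x p hd, hp.2 y hy, dist_triangle x (P x) y, dist_triangle p (P p) (P x),
        dist_comm (P x) (P p), dist_comm p (P p)]
  intro x y p q hp hq hd
  have a := key x p hp
  have b := key y q hq
  have t1 := dist_triangle4 p (P x) (P y) q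
  have t2 := dist_comm q (P y)
  have t3 := dist_triangle x (P x) p
  have t4 := dist_comm (P x) p
  have t5 := dist_triangle q (P y) y
  have := h3 x y (by linarith)
  linarith

/-- Contracting sets stay contracting under perturbations of bounded size. -/
theorem CtrWith.perturb {K D : ℝ} {Y Z : Set X} (h : CtrWith K Y) (hY : Y.Nonempty)
    (h1 : ∀ y ∈ Y, ∃ z ∈ Z, dist y z ≤ D) (h2 : ∀ z ∈ Z, ∃ y ∈ Y, dist z y ≤ D) :
    ∃ K', CtrWith K' Z := by
  have hK := h.nonneg hY
  have hD : 0 ≤ D := by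
    obtain ⟨y, hy⟩ := hY
    obtain ⟨z, -, hz⟩ := h1 y hy
    exact dist_nonneg.trans hz
  choose P hP using IsProj.exists hY
  refine ⟨_, ctrWith_of_map (K := K + D + 1) (by linarith) P ?_ ?_ ?_⟩
  · intro x
    obtain ⟨z, hz, hd⟩ := h1 (P x) (hP x).1
    exact ⟨z, hz, by linarith⟩
  · intro z hz
    obtain ⟨y, hy, hd⟩ := h2 z hz
    linarith [(hP z).2 y hy]
  · intro x y hd
    linarith [h (hP x) (hP y) (by linarith)]

/-- If `q` is far from both ends, add the contraction inequalities for `y, z₁` and `y, z₂`: the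
detour to `q` is paid twice. If `q` is near an end, the triangle inequality suffices there. -/
theorem CtrWith.quasiconvex {K : ℝ} {Z : Set X} (h : CtrWith K Z) {z₁ z₂ y q : X}
    (hz₁ : z₁ ∈ Z) (hz₂ : z₂ ∈ Z) (hy : dist z₁ y + dist y z₂ ≤ dist z₁ z₂ + K)
    (hq : IsProj Z y q) : dist y q ≤ 3 * K := by
  have hK := h.nonneg ⟨_, hz₁⟩
  have t1 := dist_triangle z₁ q z₂
  have c1 := dist_comm q z₁
  have c2 := dist_comm y z₁
  have t2 := dist_triangle y z₁ q
  have t3 := dist_triangle y z₂ q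
  have c3 := dist_comm z₂ q
  have s1 := dist_self z₁
  have s2 := dist_self z₂
  rcases le_or_gt (dist q z₁) K with h1 | h1 <;> rcases le_or_gt (dist q z₂) K with h2 | h2
  · linarith
  · have := h hq (IsProj.self hz₂) h2
    linarith
  · have := h hq (IsProj.self hz₁) h1
    linarith
  · have a := h hq (IsProj.self hz₁) h1
    have b := h hq (IsProj.self hz₂) h2
    linarith

/-- If `q₁`, `q₂` are far apart, they lie almost between `y₁` and `y₂`, hence near `Y` by
quasiconvexity, and the hypothesis bounds the distance of their projections to `Y`. -/
theorem BddProj.symm {K : ℝ} {Y Z : Set X} (hY : CtrWith K Y) (hZ : CtrWith K Z)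
    (h : BddProj Y Z) : BddProj Z Y := by
  obtain ⟨B, hB⟩ := h
  refine ⟨max K (B + 6 * K), fun y₁ hy₁ y₂ hy₂ q₁ q₂ hq₁ hq₂ => ?_⟩
  rcases le_or_gt (dist q₁ q₂) K with hd | hd
  · exact hd.trans (le_max_left _ _)
  · refine le_trans ?_ (le_max_right _ _)
    have := hZ hq₁ hq₂ hd
    obtain ⟨r₁, hr₁⟩ := IsProj.exists ⟨y₁, hy₁⟩ q₁
    obtain ⟨r₂, hr₂⟩ := IsProj.exists ⟨y₁, hy₁⟩ q₂
    have a := hY.quasiconvex hy₁ hy₂ (by linarith [dist_triangle q₁ q₂ y₂]) hr₁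
    have b := hY.quasiconvex hy₁ hy₂ (by linarith [dist_triangle y₁ q₁ q₂]) hr₂
    linarith [hB q₁ hq₁.1 q₂ hq₂.1 r₁ r₂ hr₁ hr₂, dist_triangle4 q₁ r₁ r₂ q₂, dist_comm q₂ r₂]

/-- Sets with unbounded projections come close to each other along unbounded sets. -/
theorem bddProj_of_boundedIntersection {K : ℝ} {Y Z : Set X} (hY : CtrWith K Y)
    (hZ : CtrWith K Z) {R : ℝ≥0 → ℝ≥0} (h : HasBoundedIntersection R Y Z) : BddProj Y Z := by
  refine ⟨max K (R (3 * K).toNNReal), fun z₁ hz₁ z₂ hz₂ p₁ p₂ hp₁ hp₂ => ?_⟩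
  rcases le_or_gt (dist p₁ p₂) K with hd | hd
  · exact hd.trans (le_max_left _ _)
  · refine le_trans ?_ (le_max_right _ _)
    have := hY hp₁ hp₂ hd
    have hK := hZ.nonneg ⟨z₁, hz₁⟩
    obtain ⟨q₁, hq₁⟩ := IsProj.exists ⟨z₁, hz₁⟩ p₁
    obtain ⟨q₂, hq₂⟩ := IsProj.exists ⟨z₁, hz₁⟩ p₂
    have a := hZ.quasiconvex hz₁ hz₂ (by linarith [dist_triangle p₁ p₂ z₂]) hq₁
    have b := hZ.quasiconvex hz₁ hz₂ (by linarith [dist_triangle z₁ p₁ p₂]) hq₂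
    have e : (((3 * K).toNNReal : ℝ≥0) : ℝ) = 3 * K := Real.coe_toNNReal _ (by linarith)
    refine h (3 * K).toNNReal _ ⟨?_, ?_⟩ _ ⟨?_, ?_⟩
    · exact Metric.self_subset_cthickening _ hp₁.1
    · exact Metric.mem_cthickening_of_dist_le _ q₁ _ _ hq₁.1 (by rw [e]; exact a)
    · exact Metric.self_subset_cthickening _ hp₂.1
    · exact Metric.mem_cthickening_of_dist_le _ q₂ _ _ hq₂.1 (by rw [e]; exact b)

/-- The Behrstock inequality. -/
theorem CtrWith.behrstock {K : ℝ} {Y Z : Set X} (hY : CtrWith K Y) (hZ : CtrWith K Z)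
    {x p q p' q' : X} (hp : IsProj Y x p) (hq : IsProj Z x q) (hp' : IsProj Y q p')
    (hq' : IsProj Z p q') : dist p p' ≤ K ∨ dist q q' ≤ K := by
  by_contra! hd
  have a := hY hp hp' hd.1
  have b := hZ hq hq' hd.2
  -- In the sum of `a` and `b` the distances from `x` cancel, leaving `dist p p' + dist q q' ≤ 2 *
  -- K` at most.
  linarith [hd.1, hd.2, dist_nonneg (x := p') (y := q), dist_nonneg (x := q') (y := p)]

theorem BddProj.exists_projWithin {Y Z : Set X} (h : BddProj Y Z) (o : X) :
    ∃ B, ∀ z ∈ Z, ProjWithin Y o B z := by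
  obtain ⟨B, hB⟩ := h
  by_cases hne : ∃ z ∈ Z, ∃ p, IsProj Y z p
  · obtain ⟨z, hz, p, hp⟩ := hne
    exact ⟨dist o p + B, fun z' hz' p' hp' => by
      linarith [dist_triangle o p p', hB z hz z' hz' p p' hp hp']⟩
  · exact ⟨0, fun z hz p hp => (hne ⟨z, hz, p, hp⟩).elim⟩

theorem bddProj_of_projWithin {Y Z : Set X} {o : X} {B : ℝ} (h : ∀ z ∈ Z, ProjWithin Y o B z) :
    BddProj Y Z :=
  ⟨2 * B, fun z hz z' hz' p p' hp hp' => by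
    linarith [h z hz p hp, h z' hz' p' hp', dist_triangle_left p p' o]⟩

/-- This is the form of the Behrstock inequality used for counting: the mutual projections of `Y`
and `Z` are bounded, so they can be replaced by the basepoint. -/
theorem BddProj.exists_projWithin_or {K : ℝ} {Y Z : Set X} (hY : CtrWith K Y) (hZ : CtrWith K Z)
    (h : BddProj Y Z) (o : X) : ∃ B, ∀ x, ProjWithin Y o B x ∨ ProjWithin Z o B x := by
  obtain ⟨B₁, h₁⟩ := h.exists_projWithin o
  obtain ⟨B₂, h₂⟩ := (h.symm hY hZ).exists_projWithin o
  refine ⟨max B₁ B₂ + K, fun x => ?_⟩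
  by_contra! hx
  simp only [ProjWithin, not_forall, not_le] at hx
  obtain ⟨⟨p, hp, hpd⟩, q, hq, hqd⟩ := hx
  obtain ⟨p', hp'⟩ := IsProj.exists ⟨p, hp.1⟩ q
  obtain ⟨q', hq'⟩ := IsProj.exists ⟨q, hq.1⟩ p
  have a := h₁ q hq.1 p' hp'
  have b := h₂ p hp.1 q' hq'
  have t1 := dist_triangle_right o p p'
  have t2 := dist_triangle_right o q q'
  rcases hY.behrstock hZ hp hq hp' hq' with hd | hd
  · linarith [le_max_left B₁ B₂]
  · linarith [le_max_right B₁ B₂]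

/-- If `Y` projects boundedly to `W`, and `Z` projects to `W` away from the projection of `Y`,
then `Z` projects boundedly to `Y`. -/
theorem bddProj_of_separated {K : ℝ} {Y Z W : Set X} (hY : CtrWith K Y) (hW : CtrWith K W)
    (h : BddProj W Y) {o : X} {B : ℝ}
    (hB : ∀ y ∈ Y, ProjWithin W o B y) (hZ : ∀ z ∈ Z, ∃ p, IsProj W z p ∧ B + K < dist o p) :
    BddProj Y Z := by
  obtain ⟨B', h'⟩ := (h.symm hW hY).exists_projWithin o
  refine bddProj_of_projWithin (o := o) (B := B' + K) fun z hz q hq => ?_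
  obtain ⟨p, hp, hpd⟩ := hZ z hz
  obtain ⟨p', hp'⟩ := IsProj.exists ⟨p, hp.1⟩ q
  obtain ⟨q', hq'⟩ := IsProj.exists ⟨q, hq.1⟩ p
  have a := hB q hq.1 p' hp'
  have b := h' p hp.1 q' hq'
  rcases hW.behrstock hY hp hq hp' hq' with hd | hd
  · linarith [dist_triangle_right o p p']
  · linarith [dist_triangle_right o q q']

/-- Two sets that are far apart, with mutual projections near `c` and `d`: every point projects
near `c` or near `d`. -/
theorem CtrWith.projWithin_or_of_far {K B : ℝ} {Y Z : Set X} (hY : CtrWith K Y)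
    (hZ : CtrWith K Z) {c d : X} (hd : ProjWithin Y c B d) (hc : ProjWithin Z d B c)
    (hfar : K + 2 * B < dist c d) (x : X) :
    ProjWithin Y c (B + K) x ∨ ProjWithin Z d (B + K) x := by
  by_contra! hx
  simp only [ProjWithin, not_forall, not_le] at hx
  obtain ⟨⟨p, hp, hpd⟩, q, hq, hqd⟩ := hx
  obtain ⟨p', hp'⟩ := IsProj.exists ⟨p, hp.1⟩ d
  obtain ⟨q', hq'⟩ := IsProj.exists ⟨q, hq.1⟩ c
  have a := hd p' hp'
  have b := hc q' hq'
  have a' := hY hp hp' (by linarith [dist_triangle_right c p p'])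
  have b' := hZ hq hq' (by linarith [dist_triangle_right d q q'])
  -- `a'` puts `c` almost between `x` and `d`, while `b'` puts `d` almost between `x` and `c`. The
  -- sum gives `dist c d ≤ K + 2 * B`.
  linarith [dist_triangle4 x p p' c, dist_comm p' c, dist_triangle c p' d,
    dist_triangle4 x q q' d, dist_comm q' d, dist_triangle d q' c, dist_comm c d]

end Projections

/-! ### Equivariance of projections. -/

section Action

variable {G : Type*} [Group G] {X : Type*} [MetricSpace X] [MulAction G X] [IsIsometricSMul G X]

theorem isProj_smul_iff (g : G) {Y : Set X} {x p : X} :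
    IsProj (g • Y) (g • x) (g • p) ↔ IsProj Y x p := by
  unfold IsProj
  rw [Set.smul_mem_smul_set_iff, ← Set.image_smul, Set.forall_mem_image]
  simp only [dist_smul]

theorem isProj_smul_iff_inv (g : G) {Y : Set X} {x p : X} :
    IsProj (g • Y) x p ↔ IsProj Y (g⁻¹ • x) (g⁻¹ • p) := by
  have := isProj_smul_iff g (Y := Y) (x := g⁻¹ • x) (p := g⁻¹ • p)
  rwa [smul_inv_smul, smul_inv_smul] at this

theorem dist_smul_inv (g : G) (x y : X) : dist (g⁻¹ • x) y = dist x (g • y) := by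
  rw [← dist_smul g, smul_inv_smul]

theorem CtrWith.smul {K : ℝ} {Y : Set X} (h : CtrWith K Y) (g : G) : CtrWith K (g • Y) := by
  intro x y p q hp hq hd
  have := h ((isProj_smul_iff_inv g).1 hp) ((isProj_smul_iff_inv g).1 hq)
  simpa only [dist_smul, hd, forall_true_left] using this

theorem projWithin_smul_iff (g : G) {Y : Set X} {c x : X} {B : ℝ} :
    ProjWithin (g • Y) (g • c) B (g • x) ↔ ProjWithin Y c B x := by
  constructor
  · intro h p hp
    simpa only [dist_smul] using h (g • p) ((isProj_smul_iff g).2 hp)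
  · intro h p hp
    rw [isProj_smul_iff_inv, inv_smul_smul] at hp
    have := h _ hp
    rwa [dist_comm, dist_smul_inv, dist_comm] at this

theorem BddProj.smul {Y Z : Set X} (h : BddProj Y Z) (g : G) : BddProj (g • Y) (g • Z) := by
  obtain ⟨B, hB⟩ := h
  refine ⟨B, fun z hz z' hz' p p' hp hp' => ?_⟩
  rw [Set.mem_smul_set_iff_inv_smul_mem] at hz hz'
  simpa only [dist_smul] using hB _ hz _ hz' _ _ ((isProj_smul_iff_inv g).1 hp)
    ((isProj_smul_iff_inv g).1 hp')

end Action

/-! ### Ping-pong elements and their orbits. -/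

section PingPong

/-- A coarse line: a sequence of points all of whose triples are almost aligned. -/
def IsCoarseLine {X : Type*} [MetricSpace X] (Q : Set X) : Prop :=
  ∃ (D : ℝ) (y : ℤ → X), Q = Set.range y ∧
    ∀ i j k, i ≤ j → j ≤ k → dist (y i) (y j) + dist (y j) (y k) ≤ dist (y i) (y k) + D

variable {G : Type*} [Group G] {X : Type*} [MetricSpace X] [MulAction G X]

/-- The action of `w` has two halfspaces `R` (attracting) and `L` (repelling) with bases near
`o` and `u`, such that every point lies in `R` or is moved into `L` by `w⁻¹`. -/
structure IsPingPong (w : G) (o u : X) (M : ℝ) (R L : X → Prop) : Prop where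
  path : ∀ x y, L x → R y → dist x u + dist u o + dist o y ≤ dist x y + M
  disj : ∀ x, R x → ¬ L x
  cover : ∀ x, R x ∨ L (w⁻¹ • x)
  base : R o
  base_inv : L (w⁻¹ • o)
  long : 2 * M + 1 ≤ dist u o
  nonneg : 0 ≤ M

namespace IsPingPong

variable {w : G} {o u : X} {M : ℝ} {R L : X → Prop}

theorem path' (h : IsPingPong w o u M R L) {x y : X} (hx : L x) (hy : R y) :
    dist x o + dist o y ≤ dist x y + M := by
  linarith [h.path x y hx hy, dist_triangle x u o]

theorem left_of_not_right (h : IsPingPong w o u M R L) {x : X} (hx : ¬ R x) : L (w⁻¹ • x) :=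
  (h.cover x).resolve_left hx

/-- `disj` and `cover` together make `w⁻¹` preserve `L`. -/
theorem left_pow (h : IsPingPong w o u M R L) {x : X} (hx : L x) (n : ℕ) :
    L (w ^ (-(n : ℤ)) • x) := by
  induction n with
  | zero => simpa using hx
  | succ n ih =>
    have := h.left_of_not_right (fun hR => h.disj _ hR ih)
    rwa [smul_smul, ← zpow_neg_one, ← zpow_add,
      show (-1 + -(n : ℤ)) = -((n + 1 : ℕ) : ℤ) by push_cast; ring] at this

theorem left_of_lt (h : IsPingPong w o u M R L) {x : X} {j k : ℤ} (hx : ¬ R (w ^ j • x))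
    (hk : k < j) : L (w ^ k • x) := by
  have := h.left_pow (h.left_of_not_right hx) (j - 1 - k).toNat
  rw [Int.toNat_of_nonneg (by lia), smul_smul, smul_smul, ← zpow_neg_one, ← zpow_add,
    ← zpow_add] at this
  convert this using 3
  ring

theorem right_of_le (h : IsPingPong w o u M R L) {x : X} {j k : ℤ} (hx : R (w ^ j • x))
    (hk : j ≤ k) : R (w ^ k • x) := by
  by_contra hR
  rcases hk.eq_or_lt with rfl | hk
  · exact hR hx
  · exact h.disj _ hx (h.left_of_lt hR hk)

theorem right_orbit (h : IsPingPong w o u M R L) {n : ℤ} (hn : 0 ≤ n) : R (w ^ n • o) :=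
  h.right_of_le (j := 0) (by simpa using h.base) hn

theorem left_orbit (h : IsPingPong w o u M R L) {n : ℤ} (hn : n < 0) : L (w ^ n • o) := by
  have := h.left_pow h.base_inv (-1 - n).toNat
  rw [Int.toNat_of_nonneg (by lia), smul_smul, ← zpow_neg_one, ← zpow_add] at this
  convert this using 3
  ring

variable [IsIsometricSMul G X]

theorem dist_zpow_smul (w : G) (m n : ℤ) (x y : X) :
    dist (w ^ m • x) (w ^ n • y) = dist x (w ^ (n - m) • y) := by
  rw [← dist_smul (w ^ m) x, smul_smul, ← zpow_add]
  congr 3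
  ring

theorem dist_zpow_smul' (w : G) (m n : ℤ) (x y : X) :
    dist (w ^ m • x) (w ^ n • y) = dist (w ^ (m - n) • x) y := by
  rw [dist_comm, dist_zpow_smul, dist_comm]

/-- Seen from `w ^ j • o`, earlier orbit points lie in `L` and later ones in `R`. -/
theorem aligned (h : IsPingPong w o u M R L) {i j k : ℤ} (hij : i ≤ j) (hjk : j ≤ k) :
    dist (w ^ i • o) (w ^ j • o) + dist (w ^ j • o) (w ^ k • o) ≤
      dist (w ^ i • o) (w ^ k • o) + M := by
  rcases hij.eq_or_lt with rfl | hij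
  · linarith [dist_self (w ^ i • o), h.nonneg]
  · have := h.path' (h.left_orbit (n := i - j) (by lia)) (h.right_orbit (n := k - j) (by lia))
    rw [dist_zpow_smul (m := i - j)] at this
    rw [dist_zpow_smul' w i j, dist_zpow_smul w j k, dist_zpow_smul w i k]
    convert this using 5
    ring

theorem isCoarseLine (h : IsPingPong w o u M R L) : IsCoarseLine (cyclicOrbit o w) :=
  ⟨M, fun n => w ^ n • o, rfl, fun _ _ _ => h.aligned⟩

/-- This is the purpose of the field `long`: the displacement of `w` exceeds the alignment loss `M`,
so the orbit grows linearly. -/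
theorem one_le (h : IsPingPong w o u M R L) : 1 ≤ dist o (w • o) - M := by
  have := h.path _ _ h.base_inv h.base
  rw [dist_smul_inv, dist_smul_inv] at this
  linarith [h.long, dist_self o, dist_nonneg (x := o) (y := w • u)]

theorem mul_le_dist_pow (h : IsPingPong w o u M R L) (n : ℕ) :
    n * (dist o (w • o) - M) ≤ dist o (w ^ n • o) := by
  induction n with
  | zero => simp
  | succ n ih =>
    have := h.aligned (i := 0) (j := n) (k := n + 1) (by lia) (by lia)
    rw [dist_zpow_smul w n (n + 1), add_sub_cancel_left, zpow_one, zpow_zero, one_smul,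
      zpow_natCast] at this
    have e : ((n : ℤ) + 1) = ((n + 1 : ℕ) : ℤ) := by push_cast; rfl
    rw [e, zpow_natCast] at this
    push_cast
    linarith

theorem dist_sub_le_stableLength (h : IsPingPong w o u M R L) :
    dist o (w • o) - M ≤ stableLength o w := by
  refine ge_of_tendsto (tendsto_stableLength o w) ?_
  filter_upwards [eventually_gt_atTop 0] with n hn
  have hn' : (0 : ℝ) < n := by exact_mod_cast hn
  rw [le_div_iff₀ hn', mul_comm]
  exact h.mul_le_dist_pow n

theorem dist_pow_le (w : G) (o : X) (n : ℕ) : dist o (w ^ n • o) ≤ n * dist o (w • o) := by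
  induction n with
  | zero => simp
  | succ n ih =>
    have := dist_triangle o (w ^ n • o) (w ^ (n + 1) • o)
    rw [pow_succ, mul_smul, dist_smul] at this
    rw [pow_succ, mul_smul]
    push_cast
    linarith

theorem dist_zpow_eq_natAbs (w : G) (o : X) (m n : ℤ) :
    dist (w ^ m • o) (w ^ n • o) = dist o (w ^ (m - n).natAbs • o) := by
  rw [← zpow_natCast]
  rcases le_total n m with hnm | hnm
  · rw [Int.natAbs_of_nonneg (by lia), dist_zpow_smul', dist_comm]
  · rw [Int.ofNat_natAbs_of_nonpos (by lia), dist_zpow_smul, neg_sub]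

theorem isQuasiIsometricEmbedding (h : IsPingPong w o u M R L) :
    IsQuasiIsometricEmbeddingInt fun n : ℤ => w ^ n • o := by
  have h1 := h.one_le
  have e : ∀ m n : ℤ, |(m : ℝ) - n| = ((m - n).natAbs : ℝ) := fun m n => by
    rw [Nat.cast_natAbs]; push_cast; rfl
  refine ⟨dist o (w • o), 0, by linarith [h.nonneg], le_rfl, fun m n => ?_⟩
  simp only [dist_zpow_eq_natAbs, e, sub_zero, add_zero]
  refine ⟨?_, ?_⟩
  · refine le_trans ?_ (h.mul_le_dist_pow _)
    rw [mul_comm]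
    refine mul_le_mul_of_nonneg_left ?_ (Nat.cast_nonneg _)
    refine le_trans ?_ h1
    rw [div_le_one (by linarith [h.nonneg])]
    linarith [h.nonneg]
  · rw [mul_comm]
    exact dist_pow_le w o _

theorem dist_zpow_le (w : G) (o : X) {m n : ℤ} {N : ℕ} (hmn : (m - n).natAbs ≤ N) :
    dist (w ^ m • o) (w ^ n • o) ≤ N * dist o (w • o) := by
  rw [dist_zpow_eq_natAbs]
  exact (dist_pow_le w o _).trans
    (mul_le_mul_of_nonneg_right (by exact_mod_cast hmn) dist_nonneg)

/-- Every point has a last translate in the right halfspace. -/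
theorem exists_transition (h : IsPingPong w o u M R L) (x : X) :
    ∃ k : ℤ, R (w ^ (-k) • x) ∧ ∀ j, R (w ^ (-j) • x) → j ≤ k := by
  -- Since `w ^ n` moves `o` by at least `n`, a larger power takes `x` to the expected side of `o`.
  -- The extra `1` pays for the index shift in `left_of_lt`.
  obtain ⟨N, hN⟩ := exists_nat_gt (dist o x + M + 1)
  have hpos : ∀ n : ℕ, (n : ℝ) ≤ dist o (w ^ n • o) := fun n =>
    (le_mul_of_one_le_right (Nat.cast_nonneg n) h.one_le).trans (h.mul_le_dist_pow n)
  have hN0 : 0 < N := by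
    have : (0 : ℝ) < N := by linarith [dist_nonneg (x := o) (y := x), h.nonneg]
    exact_mod_cast this
  refine Int.exists_greatest_of_bdd ⟨N, fun j hj => ?_⟩ ⟨-N, ?_⟩
  · by_contra! hNj
    have hj' := h.right_of_le hj (show -j ≤ -(N : ℤ) by lia)
    have := h.path' (h.left_orbit (n := -N) (by lia)) hj'
    rw [dist_zpow_smul w, sub_self, zpow_zero, one_smul, dist_comm _ o] at this
    have e := dist_zpow_eq_natAbs w o 0 (-N)
    simp only [zpow_zero, one_smul, zero_sub, neg_neg, Int.natAbs_natCast] at e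
    rw [e] at this
    linarith [hpos N, dist_nonneg (x := o) (y := w ^ (-(N : ℤ)) • x)]
  · rw [neg_neg]
    by_contra hR
    have hl := h.left_of_lt hR (k := N - 1) (by lia)
    have := h.path' hl (h.right_orbit (n := N - 1) (by lia))
    rw [dist_zpow_smul w, sub_self, zpow_zero, one_smul] at this
    have e : ((N : ℤ) - 1) = ((N - 1 : ℕ) : ℤ) := by lia
    have hp := hpos (N - 1)
    rw [e, zpow_natCast] at this
    push_cast [Nat.cast_sub (show 1 ≤ N from hN0)] at hp
    linarith [dist_comm x o, dist_nonneg (x := w ^ (N - 1) • x) (y := o)]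

/-- The map `x ↦ w ^ k x • o` serves as projection, with `k x` the transition index. If `k x + 2 ≤ k
y`, then `w ^ (k x + 2) • o` has `x` on its left and `y` on its right; the shift by 2 is needed
because one translate of `x` may lie in neither halfspace. -/
theorem ctrWith_orbit (h : IsPingPong w o u M R L) : ∃ K, CtrWith K (cyclicOrbit o w) := by
  choose k hk hkmax using h.exists_transition
  have hM := h.nonneg
  set D := dist o (w • o) with hD
  have hD0 : 0 ≤ D := dist_nonneg
  have main : ∀ x y, k x ≤ k y → 2 * M + 4 * D < dist (w ^ k x • o) (w ^ k y • o) →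
      dist x (w ^ k x • o) + dist (w ^ k x • o) (w ^ k y • o) + dist (w ^ k y • o) y
        ≤ dist x y + (2 * M + 4 * D) := by
    intro x y hxy hd
    have hlt : k x + 2 ≤ k y := by
      by_contra! hlt
      have := dist_zpow_le w o (m := k x) (n := k y) (N := 1) (by lia)
      push_cast at this
      linarith
    have hl : L (w ^ (-(k x + 2)) • x) := by
      refine h.left_of_lt (j := -(k x + 1)) (fun hR => ?_) (by lia)
      linarith [hkmax x _ hR]
    have hr : R (w ^ (-(k x + 2)) • y) := h.right_of_le (hk y) (by lia)
    have a := h.path' hl hr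
    rw [dist_zpow_smul w, sub_self, zpow_zero, one_smul, dist_comm _ o] at a
    have a1 := dist_zpow_smul w (k x + 2) 0 o x
    have a2 := dist_zpow_smul w (k x + 2) 0 o y
    simp only [zpow_zero, one_smul, zero_sub] at a1 a2
    rw [← a1, ← a2] at a
    have b : dist (w ^ (k x + 2) • o) (w ^ k y • o) + dist (w ^ k y • o) y ≤
        dist (w ^ (k x + 2) • o) y + M := by
      rcases hlt.eq_or_lt with e | hlt
      · rw [e, dist_self]; linarith
      · have := h.path' (h.left_orbit (n := k x + 2 - k y) (by lia)) (hk y)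
        have b1 := dist_zpow_smul w (k y) 0 o y
        have b2 := dist_zpow_smul w (k x + 2) 0 o y
        have b3 := dist_zpow_smul' w (k x + 2) (k y) o o
        simp only [zpow_zero, one_smul, zero_sub] at b1 b2
        rw [dist_zpow_smul w, ← b1, ← b3, show -k y - (k x + 2 - k y) = -(k x + 2) by ring,
          ← b2] at this
        exact this
    have c := dist_zpow_le w o (m := k x) (n := k x + 2) (N := 2) (by lia)
    push_cast at c
    linarith [dist_triangle (w ^ k x • o) (w ^ (k x + 2) • o) (w ^ k y • o),
      dist_triangle_right x (w ^ k x • o) (w ^ (k x + 2) • o), dist_comm x (w ^ (k x + 2) • o)]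
  refine ⟨_, ctrWith_of_map (K := 2 * M + 4 * D) (by linarith) (fun x => w ^ k x • o)
    (fun x => ⟨_, ⟨k x, rfl⟩, by rw [dist_self]; linarith⟩) ?_ ?_⟩
  · rintro _ ⟨i, rfl⟩
    have e : k (w ^ i • o) = i := by
      refine le_antisymm ?_ ?_
      · have := hk (w ^ i • o)
        rw [smul_smul, ← zpow_add] at this
        by_contra! hlt
        exact h.disj _ this (h.left_orbit (by lia))
      · refine hkmax _ i ?_
        rw [smul_smul, ← zpow_add, neg_add_cancel]
        exact h.right_orbit le_rfl
    simp only [e, dist_self]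
    linarith
  · intro x y hd
    rcases le_total (k x) (k y) with hxy | hxy
    · exact main x y hxy hd
    · rw [dist_comm] at hd
      have := main y x hxy hd
      linarith [dist_comm x y, dist_comm x (w ^ k x • o), dist_comm y (w ^ k y • o),
        dist_comm (w ^ k x • o) (w ^ k y • o)]

end IsPingPong

/-- If `t o` and `t⁻¹ o` project near `o` to a contracting set that is invariant under `b`, and
both `t` and `b` move `o` far, then `t * b` plays ping-pong. -/
theorem isPingPong_mul [IsIsometricSMul G X] {K B : ℝ} {Y : Set X} (hY : CtrWith K Y)
    (hne : Y.Nonempty) {b t : G} {o : X} (hb : b • Y = Y) (h0 : ProjWithin Y o B o)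
    (h1 : ProjWithin Y o B (t • o)) (h2 : ProjWithin Y o B (t⁻¹ • o))
    (ht : K + 2 * B < dist o (t • o)) (hbo : 10 * K + 8 * B + 1 ≤ dist o (b • o)) :
    IsPingPong (t * b) o (b⁻¹ • o) (5 * K + 4 * B) (ProjWithin Y o (B + K))
      (ProjWithin Y (b⁻¹ • o) (B + K)) := by
  have hK := hY.nonneg hne
  have hB : 0 ≤ B := by
    obtain ⟨p, hp⟩ := IsProj.exists hne o
    exact dist_nonneg.trans (h0 p hp)
  have hb' : b⁻¹ • Y = Y := by rw [inv_smul_eq_iff, hb]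
  have hbo' : dist (b⁻¹ • o) o = dist o (b • o) := dist_smul_inv b o o
  have tr : ∀ x C, ProjWithin Y (b⁻¹ • o) C (b⁻¹ • x) ↔ ProjWithin Y o C x := fun x C => by
    have := projWithin_smul_iff b⁻¹ (Y := Y) (c := o) (x := x) (B := C)
    rwa [hb'] at this
  refine ⟨?_, ?_, ?_, ?_, ?_, ?_, by linarith⟩
  -- Moving `p` to `b⁻¹ • o` and `q` to `o` costs `B + K` twice each; with the `K` from contraction
  -- this is `5 * K + 4 * B`.
  · intro x y hx hy
    obtain ⟨p, hp⟩ := IsProj.exists hne x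
    obtain ⟨q, hq⟩ := IsProj.exists hne y
    have hpd := hx p hp
    have hqd := hy q hq
    have t1 := dist_triangle4 (b⁻¹ • o) p q o
    have := hY hp hq (by linarith [dist_comm q o])
    linarith [dist_triangle x p (b⁻¹ • o), dist_comm p (b⁻¹ • o), dist_triangle o q y,
      dist_comm q o]
  · intro x hx hx'
    obtain ⟨p, hp⟩ := IsProj.exists hne x
    linarith [hx p hp, hx' p hp, dist_triangle_right (b⁻¹ • o) o p]
  -- `Y` and `t • Y` are far apart, so `x` projects to `Y` near `o` or to `t • Y` near `t • o`. In
  -- the second case `b⁻¹ • t⁻¹ • x` projects to `Y` near `b⁻¹ • o`.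
  · intro x
    have ht' : ProjWithin (t • Y) (t • o) B o := by
      have := (projWithin_smul_iff t (Y := Y) (c := o) (x := t⁻¹ • o) (B := B)).2 h2
      rwa [smul_inv_smul] at this
    refine (hY.projWithin_or_of_far (hY.smul t) h1 ht' ht x).imp id fun h => ?_
    rw [mul_inv_rev, mul_smul, tr, ← projWithin_smul_iff t, smul_inv_smul]
    exact h
  · exact h0.mono (by linarith)
  · rw [mul_inv_rev, mul_smul, tr]
    exact h2.mono (by linarith)
  · rw [hbo']
    linarith

end PingPong

/-! ### Equivalence with the geodesic definition of contracting. -/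

section Geodesic

variable {X : Type*} [MetricSpace X]

theorem IsGeodesicSegment.subsegment {α : ℝ → X} {L a b : ℝ} (h : IsGeodesicSegment α L)
    (ha : 0 ≤ a) (hab : a ≤ b) (hb : b ≤ L) :
    IsGeodesicSegment (fun t => α (a + t)) (b - a) := by
  refine ⟨by linarith, fun s hs t ht => ?_⟩
  rw [h.2 _ ⟨by linarith [hs.1], by linarith [hs.2]⟩ _ ⟨by linarith [ht.1], by linarith [ht.2]⟩]
  congr 1
  ring

theorem IsContractingWith.dist_le {C : ℝ} {Y : Set X} (h : IsContractingWith C Y) {α : ℝ → X}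
    {L a b : ℝ} (hα : IsGeodesicSegment α L) (ha : 0 ≤ a) (hab : a ≤ b) (hb : b ≤ L)
    (hC : ∀ t ∈ Set.Icc a b, C ≤ Metric.infDist (α t) Y) {s t : ℝ} (hs : s ∈ Set.Icc a b)
    (ht : t ∈ Set.Icc a b) {p q : X} (hp : p ∈ closestProj Y (α s))
    (hq : q ∈ closestProj Y (α t)) : dist p q ≤ C := by
  refine h _ _ (hα.subsegment ha hab hb) (fun t ht => hC _ ⟨?_, ?_⟩) p ?_ q ?_
  · linarith [ht.1]
  · linarith [ht.2]
  · exact Set.mem_biUnion ⟨s - a, ⟨by linarith [hs.1], by linarith [hs.2]⟩, by simp⟩ hp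
  · exact Set.mem_biUnion ⟨t - a, ⟨by linarith [ht.1], by linarith [ht.2]⟩, by simp⟩ hq

theorem isProj_iff_mem_coarselyNearestPoints {Y : Set X} {x p : X} :
    IsProj Y x p ↔ p ∈ coarselyNearestPoints Y x := by
  refine and_congr_right fun hp => ⟨fun h => ?_, fun h y hy => ?_⟩
  · have : dist x p - 1 ≤ Metric.infDist x Y :=
      (Metric.le_infDist ⟨p, hp⟩).2 fun {y} hy => by linarith [h y hy]
    linarith
  · linarith [Metric.infDist_le_dist_of_mem (x := x) hy]

theorem exists_mem_closestProj {Y : Set X} (hY : Y.Nonempty) (x : X) :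
    ∃ p, p ∈ closestProj Y x := by
  by_cases hP : ProperSpace X
  · obtain ⟨p, hp, hd⟩ := isClosed_closure.exists_infDist_eq_dist hY.closure x
    exact ⟨p, Or.inl ⟨hP, hp, by rw [← hd, Metric.infDist_closure]⟩⟩
  · obtain ⟨p, hp⟩ := IsProj.exists hY x
    exact ⟨p, Or.inr ⟨hP, isProj_iff_mem_coarselyNearestPoints.1 hp⟩⟩

theorem exists_isProj_dist_le {Y : Set X} {x p : X} (hp : p ∈ closestProj Y x) :
    ∃ q, IsProj Y x q ∧ dist p q ≤ 1 := by
  rcases hp with ⟨-, hp, hd⟩ | ⟨-, hp⟩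
  · obtain ⟨q, hq, hqd⟩ := Metric.mem_closure_iff.1 hp 1 one_pos
    refine ⟨q, isProj_iff_mem_coarselyNearestPoints.2 ⟨hq, ?_⟩, hqd.le⟩
    linarith [dist_triangle x p q]
  · exact ⟨p, isProj_iff_mem_coarselyNearestPoints.2 hp, by simp⟩

theorem dist_le_of_mem_closestProj {Y : Set X} {x p : X} (hp : p ∈ closestProj Y x) :
    dist x p ≤ Metric.infDist x Y + 1 := by
  rcases hp with ⟨-, hp, hd⟩ | ⟨-, hp, hd⟩ <;> linarith

/-- The first point at which a geodesic segment enters the closed `C`-neighbourhood of `Y`. -/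
theorem IsGeodesicSegment.exists_first {α : ℝ → X} {L C : ℝ} {Y : Set X}
    (h : IsGeodesicSegment α L) (hne : ∃ t ∈ Set.Icc 0 L, Metric.infDist (α t) Y ≤ C) :
    ∃ t ∈ Set.Icc 0 L, Metric.infDist (α t) Y ≤ C ∧
      (t = 0 ∨ ∀ s ∈ Set.Icc 0 t, C ≤ Metric.infDist (α s) Y) := by
  have lip : ∀ s ∈ Set.Icc 0 L, ∀ t ∈ Set.Icc 0 L,
      Metric.infDist (α s) Y ≤ Metric.infDist (α t) Y + |s - t| := fun s hs t ht => by
    rw [← h.2 s hs t ht]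
    exact Metric.infDist_le_infDist_add_dist
  have hcont : ContinuousOn α (Set.Icc 0 L) := by
    refine (LipschitzOnWith.of_dist_le_mul (K := 1) fun s hs t ht => ?_).continuousOn
    rw [h.2 s hs t ht, Real.dist_eq, NNReal.coe_one, one_mul]
  have hcl : IsClosed (Set.Icc 0 L ∩ (fun t => Metric.infDist (α t) Y) ⁻¹' Set.Iic C) :=
    ((Metric.continuous_infDist_pt Y).comp_continuousOn hcont).preimage_isClosed_of_isClosed
      isClosed_Icc isClosed_Iic
  obtain ⟨t, ⟨ht, htC⟩, hmin⟩ := (isCompact_Icc.of_isClosed_subset hcl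
    Set.inter_subset_left).exists_isLeast (by obtain ⟨t, ht, htC⟩ := hne; exact ⟨t, ht, htC⟩)
  refine ⟨t, ht, htC, or_iff_not_imp_left.2 fun h0 s hs => ?_⟩
  by_contra! hlt
  have hsL : s ∈ Set.Icc 0 L := ⟨hs.1, hs.2.trans ht.2⟩
  have hts : t ≤ s := hmin ⟨hsL, hlt.le⟩
  obtain rfl : s = t := le_antisymm hs.2 hts
  have hpos : 0 < s := lt_of_le_of_ne hs.1 (Ne.symm h0)
  -- The distance to `Y` is 1-Lipschitz along `α`, so stepping back by `δ` stays within `C` and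
  -- contradicts minimality.
  set δ := min s (C - Metric.infDist (α s) Y) with hδ
  have hδ0 : 0 < δ := lt_min hpos (by linarith)
  have hδs : δ ≤ s := min_le_left _ _
  have hmem : s - δ ∈ Set.Icc 0 L := ⟨by linarith, by linarith [ht.2]⟩
  have := lip _ hmem _ ht
  rw [show s - δ - s = -δ by ring, abs_neg, abs_of_pos hδ0] at this
  have : s ≤ s - δ := hmin ⟨hmem, by
    simp only [Set.mem_preimage, Set.mem_Iic]
    linarith [min_le_right s (C - Metric.infDist (α s) Y)]⟩
  linarith

theorem IsGeodesicSegment.reverse {α : ℝ → X} {L : ℝ} (h : IsGeodesicSegment α L) :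
    IsGeodesicSegment (fun t => α (L - t)) L := by
  refine ⟨h.1, fun s hs t ht => ?_⟩
  rw [h.2 _ ⟨by linarith [hs.2], by linarith [hs.1]⟩ _ ⟨by linarith [ht.2], by linarith [ht.1]⟩,
    ← abs_neg]
  congr 1
  ring

/-- A geodesic that comes close to `Y` passes near the projection of its starting point. -/
theorem IsContractingWith.exists_near {C : ℝ} (hC : 0 ≤ C) {Y : Set X}
    (h : IsContractingWith C Y) {α : ℝ → X} {L : ℝ} (hα : IsGeodesicSegment α L)
    (hne : ∃ t ∈ Set.Icc 0 L, Metric.infDist (α t) Y ≤ C) {p : X} (hY : Y.Nonempty)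
    (hp : p ∈ closestProj Y (α 0)) : ∃ t ∈ Set.Icc 0 L, dist (α t) p ≤ 2 * C + 1 ∧
      ∀ s ∈ Set.Icc 0 L, Metric.infDist (α s) Y < C → t ≤ s := by
  obtain ⟨t, ht, htC, h0⟩ := hα.exists_first hne
  obtain ⟨q, hq⟩ := exists_mem_closestProj hY (α t)
  have hqd := dist_le_of_mem_closestProj hq
  rcases h0 with rfl | h0
  · exact ⟨0, ht, by linarith [dist_le_of_mem_closestProj hp], fun s hs _ => hs.1⟩
  · refine ⟨t, ht, ?_, fun s hs hlt => ?_⟩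
    · have := h.dist_le hα le_rfl ht.1 ht.2 h0 (Set.left_mem_Icc.2 ht.1)
        (Set.right_mem_Icc.2 ht.1) hp hq
      linarith [dist_triangle_right (α t) p q]
    · by_contra! hst
      linarith [h0 s ⟨hs.1, hst.le⟩]

/-- A geodesic between points with distant projections must come close to `Y`. It then passes within
`2 * C + 1` of both projections, in the right order, and the detour through them uses this bound
four times. -/
theorem IsContractingSet.exists_ctrWith (hX : IsGeodesicSpace X) {Y : Set X} (hY : Y.Nonempty)
    (h : IsContractingSet Y) : ∃ K, CtrWith K Y := by
  obtain ⟨C, hC, h⟩ := h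
  choose P hP using exists_mem_closestProj hY
  refine ⟨_, ctrWith_of_map (K := 4 * (2 * C + 1)) (by linarith) P ?_ ?_ ?_⟩
  · intro x
    obtain ⟨q, hq, hqd⟩ := exists_isProj_dist_le (hP x)
    exact ⟨q, hq.1, by linarith⟩
  · intro y hy
    linarith [dist_le_of_mem_closestProj (hP y), Metric.infDist_zero_of_mem hy]
  · intro x y hd
    obtain ⟨L, α, hα, rfl, rfl⟩ := hX x y
    by_cases hfar : ∀ t ∈ Set.Icc 0 L, C ≤ Metric.infDist (α t) Y
    · have := h.dist_le hα le_rfl hα.1 le_rfl hfar (Set.left_mem_Icc.2 hα.1)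
        (Set.right_mem_Icc.2 hα.1) (hP _) (hP _)
      linarith
    · push Not at hfar
      obtain ⟨s, hs, hsC⟩ := hfar
      obtain ⟨t, ht, htd, htm⟩ := h.exists_near hC hα ⟨s, hs, hsC.le⟩ hY (hP _)
      have hs' : L - s ∈ Set.Icc 0 L := ⟨by linarith [hs.2], by linarith [hs.1]⟩
      obtain ⟨t', ht', htd', htm'⟩ := h.exists_near hC hα.reverse
        ⟨L - s, hs', by simpa using hsC.le⟩ hY (p := P (α L)) (by simpa using hP (α L))
      have a := htm s hs hsC
      have b := htm' (L - s) hs' (by simpa using hsC)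
      have hL' : L - t' ∈ Set.Icc 0 L := ⟨by linarith [ht'.2], by linarith [ht'.1]⟩
      have e1 := hα.2 0 ⟨le_rfl, hα.1⟩ t ht
      have e2 := hα.2 t ht (L - t') hL'
      have e3 := hα.2 (L - t') hL' L ⟨hα.1, le_rfl⟩
      have e4 := hα.2 0 ⟨le_rfl, hα.1⟩ L ⟨hα.1, le_rfl⟩
      rw [abs_of_nonpos (by linarith [ht.1])] at e1
      rw [abs_of_nonpos (by linarith)] at e2
      rw [abs_of_nonpos (by linarith [ht'.1])] at e3
      rw [abs_of_nonpos (by linarith [hα.1])] at e4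
      linarith [dist_triangle (α 0) (α t) (P (α 0)),
        dist_triangle4 (P (α 0)) (α t) (α (L - t')) (P (α L)), dist_comm (α t) (P (α 0)),
        dist_triangle (P (α L)) (α (L - t')) (α L), dist_comm (α (L - t')) (P (α L))]

/-- Suppose `p`, `q` are more than `2 * K` apart, and let `α v` be as far from `α s` as `p` is. Its
projection `r` is within `K` of `p`, hence far from `q`, and contraction then puts `α v` within `2 *
K` of `Y`. -/
theorem CtrWith.isContractingSet {K : ℝ} {Y : Set X} (hY : Y.Nonempty) (h : CtrWith K Y) :
    IsContractingSet Y := by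
  have hK := h.nonneg hY
  have key : ∀ (L : ℝ) (α : ℝ → X), IsGeodesicSegment α L →
      (∀ t ∈ Set.Icc 0 L, 2 * K + 2 ≤ Metric.infDist (α t) Y) → ∀ s ∈ Set.Icc 0 L,
      ∀ t ∈ Set.Icc 0 L, s ≤ t → ∀ p q, IsProj Y (α s) p → IsProj Y (α t) q →
      dist p q ≤ 2 * K := by
    intro L α hα hfar s hs t ht hst p q hp hq
    by_contra! hd
    have a := h hp hq (by linarith)
    have est := hα.2 s hs t ht
    rw [abs_of_nonpos (by linarith)] at est
    have hle : dist (α s) p ≤ t - s := by linarith [dist_nonneg (x := q) (y := α t)]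
    have hv : s + dist (α s) p ∈ Set.Icc 0 L :=
      ⟨by linarith [hs.1, dist_nonneg (x := α s) (y := p)], by linarith [ht.2]⟩
    set v := s + dist (α s) p with hvdef
    have esv := hα.2 s hs v hv
    have evt := hα.2 v hv t ht
    rw [abs_of_nonpos (by linarith [dist_nonneg (x := α s) (y := p)])] at esv
    rw [abs_of_nonpos (by linarith)] at evt
    obtain ⟨r, hr⟩ := IsProj.exists hY (α v)
    have hpr : dist p r ≤ K := by
      by_contra! hpr
      linarith [h hp hr hpr, dist_nonneg (x := r) (y := α v)]
    have b := h hr hq (by linarith [dist_triangle p r q])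
    linarith [hfar v hv, Metric.infDist_le_dist_of_mem (x := α v) hr.1, dist_triangle p r q,
      dist_triangle4 (α s) p q (α t)]
  refine ⟨2 * K + 2, by linarith, fun L α hα hfar => ?_⟩
  intro p hp q hq
  simp only [closestProjSet, Set.mem_iUnion] at hp hq
  obtain ⟨_, ⟨s, hs, rfl⟩, hp⟩ := hp
  obtain ⟨_, ⟨t, ht, rfl⟩, hq⟩ := hq
  obtain ⟨p', hp', hpd⟩ := exists_isProj_dist_le hp
  obtain ⟨q', hq', hqd⟩ := exists_isProj_dist_le hq
  have : dist p' q' ≤ 2 * K := by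
    rcases le_total s t with hst | hst
    · exact key L α hα hfar s hs t ht hst _ _ hp' hq'
    · rw [dist_comm]
      exact key L α hα hfar t ht s hs hst _ _ hq' hp'
  linarith [dist_triangle4 p p' q' q, dist_comm q' q]

end Geodesic

/-! ### Contracting elements and conjugation. -/

section ContractingElement

theorem cyclicOrbit_nonempty {G : Type*} [Group G] {X : Type*} [MulAction G X] (o : X) (g : G) : (cyclicOrbit o g).Nonempty := Set.range_nonempty _

theorem smul_cyclicOrbit {G : Type*} [Group G] {X : Type*} [MulAction G X] (o : X) (g : G) : g • cyclicOrbit o g = cyclicOrbit o g := by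
  ext x
  simp only [cyclicOrbit, Set.mem_smul_set, Set.mem_range, exists_exists_eq_and, smul_smul,
    ← zpow_one_add]
  exact ⟨fun ⟨n, hn⟩ => ⟨1 + n, hn⟩, fun ⟨n, hn⟩ => ⟨n - 1, by rwa [add_sub_cancel]⟩⟩

variable {G : Type*} [Group G] {X : Type*} [MetricSpace X] [MulAction G X]

theorem isContractingElement_iff (hX : IsGeodesicSpace X) {o : X} {g : G} :
    IsContractingElement o g ↔ (∃ K, CtrWith K (cyclicOrbit o g)) ∧
      IsQuasiIsometricEmbeddingInt fun n : ℤ => g ^ n • o :=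
  and_congr_left fun _ => ⟨fun h => h.exists_ctrWith hX (cyclicOrbit_nonempty o g),
    fun ⟨_, h⟩ => h.isContractingSet (cyclicOrbit_nonempty o g)⟩

variable [IsIsometricSMul G X]

theorem IsPingPong.isContractingElement (hX : IsGeodesicSpace X) {w : G} {o u : X} {M : ℝ}
    {R L : X → Prop} (h : IsPingPong w o u M R L) : IsContractingElement o w :=
  (isContractingElement_iff hX).2 ⟨h.ctrWith_orbit, h.isQuasiIsometricEmbedding⟩

theorem IsContractingElement.conj (hX : IsGeodesicSpace X) {o : X} {g : G}
    (h : IsContractingElement o g) (t : G) : IsContractingElement o (t * g * t⁻¹) := by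
  rw [isContractingElement_iff hX] at h ⊢
  obtain ⟨⟨K, hK⟩, k, c, hk, hc, hq⟩ := h
  have hclose : ∀ n : ℤ, dist (t • g ^ n • o) ((t * g * t⁻¹) ^ n • o) = dist o (t⁻¹ • o) :=
    fun n => by rw [conj_zpow, mul_smul, mul_smul, dist_smul, dist_smul]
  refine ⟨(hK.smul t).perturb ((cyclicOrbit_nonempty o g).smul_set) (D := dist o (t⁻¹ • o))
    ?_ ?_, k, c + 2 * dist o (t⁻¹ • o), hk, by positivity, fun m n => ?_⟩
  · rintro _ ⟨_, ⟨n, rfl⟩, rfl⟩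
    exact ⟨_, ⟨n, rfl⟩, (hclose n).le⟩
  · rintro _ ⟨n, rfl⟩
    exact ⟨_, ⟨_, ⟨n, rfl⟩, rfl⟩, by rw [dist_comm]; exact (hclose n).le⟩
  · have hmn := hq m n
    rw [← dist_smul t] at hmn
    have a := dist_triangle4 (t • g ^ m • o) ((t * g * t⁻¹) ^ m • o) ((t * g * t⁻¹) ^ n • o)
      (t • g ^ n • o)
    have b := dist_triangle4 ((t * g * t⁻¹) ^ m • o) (t • g ^ m • o) (t • g ^ n • o)
      ((t * g * t⁻¹) ^ n • o)
    have em := hclose m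
    have en := hclose n
    have em' := dist_comm ((t * g * t⁻¹) ^ m • o) (t • g ^ m • o)
    have en' := dist_comm ((t * g * t⁻¹) ^ n • o) (t • g ^ n • o)
    dsimp only at hmn ⊢
    constructor <;> linarith [hmn.1, hmn.2]

end ContractingElement

/-! ### Counting exceptions. -/

section Counting

open Classical in
/-- The predicate `P` fails at most `k` times. -/
def FailsAtMost {ι : Type*} [Fintype ι] (k : ℕ) (P : ι → Prop) : Prop :=
  (Finset.univ.filter fun i => ¬ P i).card ≤ k

variable {ι κ : Type*} [Fintype ι] [Fintype κ]

theorem FailsAtMost.and {k l : ℕ} {P Q : ι → Prop} (hP : FailsAtMost k P)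
    (hQ : FailsAtMost l Q) : FailsAtMost (k + l) fun i => P i ∧ Q i := by
  classical
  refine le_trans ?_ (add_le_add hP hQ)
  refine le_trans (Finset.card_le_card fun i hi => ?_) (Finset.card_union_le _ _)
  simp only [Finset.mem_filter, Finset.mem_univ, true_and, Finset.mem_union] at hi ⊢
  tauto

theorem FailsAtMost.exists {k : ℕ} {P : ι → Prop} (hP : FailsAtMost k P)
    (hk : k < Fintype.card ι) : ∃ i, P i := by
  classical
  by_contra! h
  unfold FailsAtMost at hP
  rw [Finset.filter_true_of_mem fun i _ => h i, Finset.card_univ] at hP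
  lia

theorem failsAtMost_one {P : ι → Prop} (h : ∀ i j, i ≠ j → P i ∨ P j) : FailsAtMost 1 P := by
  classical
  refine Finset.card_le_one.2 fun i hi j hj => ?_
  simp only [Finset.mem_filter, Finset.mem_univ, true_and] at hi hj
  by_contra hij
  exact (h i j hij).elim hi hj

theorem failsAtMost_two {P : ι → Prop}
    (h : ∀ i j k, i ≠ j → i ≠ k → j ≠ k → P i ∨ P j ∨ P k) : FailsAtMost 2 P := by
  classical
  unfold FailsAtMost
  by_contra! hlt
  obtain ⟨i, j, k, hi, hj, hk, hij, hik, hjk⟩ := Finset.two_lt_card_iff.1 hlt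
  simp only [Finset.mem_filter, Finset.mem_univ, true_and] at hi hj hk
  have := h i j k hij hik hjk
  tauto

/-- Double counting: the bad pairs do not exhaust the product. It is needed because the admissible
`i` depend on `j` and conversely. -/
theorem FailsAtMost.exists_pair {a b : ℕ} {P Q : ι → κ → Prop}
    (hP : ∀ j, FailsAtMost a fun i => P i j) (hQ : ∀ i, FailsAtMost b fun j => Q i j)
    (hab : a * Fintype.card κ + b * Fintype.card ι < Fintype.card ι * Fintype.card κ) :
    ∃ i j, P i j ∧ Q i j := by
  classical
  by_contra! h
  unfold FailsAtMost at hP hQ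
  have h1 : ∑ j : κ, (Finset.univ.filter fun i : ι => ¬ P i j).card ≤ a * Fintype.card κ := by
    rw [mul_comm, ← smul_eq_mul]
    exact Finset.sum_le_card_nsmul _ _ _ fun j _ => by convert hP j
  have h2 : ∑ i : ι, (Finset.univ.filter fun j : κ => ¬ Q i j).card ≤ b * Fintype.card ι := by
    rw [mul_comm, ← smul_eq_mul]
    exact Finset.sum_le_card_nsmul _ _ _ fun i _ => by convert hQ i
  simp only [Finset.card_filter] at h1 h2
  rw [Finset.sum_comm] at h1
  have h3 : Fintype.card ι * Fintype.card κ = ∑ _i : ι, ∑ _j : κ, 1 := by simp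
  have h4 : ∑ _i : ι, ∑ _j : κ, 1 ≤ (∑ i : ι, ∑ j : κ, if ¬ P i j then 1 else 0) +
      ∑ i : ι, ∑ j : κ, if ¬ Q i j then 1 else 0 := by
    simp only [← Finset.sum_add_distrib]
    refine Finset.sum_le_sum fun i _ => Finset.sum_le_sum fun j _ => ?_
    by_cases hp : P i j
    · simp [hp, h i j hp]
    · simp [hp]
  lia

end Counting

/-! ### Families of independent axes. -/

section Axes

theorem pow_smul_eq {G : Type*} [Group G] {X : Type*} [MulAction G X] {b : G} {Y : Set X}
    (h : b • Y = Y) (n : ℕ) : b ^ n • Y = Y := by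
  induction n with
  | zero => simp
  | succ n ih => rw [pow_succ, mul_smul, h, ih]

variable {G : Type*} [Group G] {X : Type*} [MetricSpace X] [MulAction G X]

/-- `Y` is a contracting set, invariant under `b`, and the powers of `b` tend to infinity. -/
structure IsAxis (o : X) (b : G) (Y : Set X) : Prop where
  nonempty : Y.Nonempty
  ctr : ∃ K, CtrWith K Y
  smul_eq : b • Y = Y
  diverge : ∀ M : ℝ, ∃ N : ℕ, ∀ n ≥ N, M ≤ dist o (b ^ n • o)

theorem IsContractingElement.isAxis (hX : IsGeodesicSpace X) {o : X} {g : G}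
    (h : IsContractingElement o g) : IsAxis o g (cyclicOrbit o g) := by
  obtain ⟨hK, k, c, hk, hc, hq⟩ := (isContractingElement_iff hX).1 h
  refine ⟨cyclicOrbit_nonempty o g, hK, smul_cyclicOrbit o g, fun M => ?_⟩
  obtain ⟨N, hN⟩ := exists_nat_gt (k * (M + c))
  refine ⟨N, fun n hn => ?_⟩
  have := (hq 0 n).1
  simp only [Int.cast_zero, zero_sub, abs_neg, Int.cast_natCast, Nat.abs_cast, zpow_zero,
    one_smul, zpow_natCast] at this
  have hn' : (N : ℝ) ≤ n := by exact_mod_cast hn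
  have : M + c ≤ 1 / k * n := by
    rw [one_div, ← div_eq_inv_mul, le_div_iff₀ (by linarith)]
    linarith
  linarith

/-- A finite family of axes with pairwise bounded projections, with uniform constants. -/
structure IsIndepFamily {ι : Type*} (o : X) (K B : ℝ) (b : ι → G) (Z : ι → Set X) : Prop where
  nonempty : ∀ i, (Z i).Nonempty
  ctr : ∀ i, CtrWith K (Z i)
  smul_eq : ∀ i, b i • Z i = Z i
  sep : ∀ i j, i ≠ j → ∀ x, ProjWithin (Z i) o B x ∨ ProjWithin (Z j) o B x
  base : ∀ i, ProjWithin (Z i) o B o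
  nonneg : 0 ≤ B
  nonneg' : 0 ≤ K

/-- The constants precede `n`: powers preserve the same axes, so the exponent can later be chosen
large in terms of `K` and `B`. -/
theorem exists_isIndepFamily {ι : Type*} [Finite ι] {o : X} {b : ι → G} {Z : ι → Set X}
    (h : ∀ i, IsAxis o (b i) (Z i)) (hZ : ∀ i j, i ≠ j → BddProj (Z i) (Z j)) :
    ∃ K B, ∀ n : ℕ, IsIndepFamily o K B (fun i => b i ^ n) Z := by
  choose K hK using fun i => (h i).ctr
  obtain ⟨K₀, hK₀⟩ := Finite.exists_le K
  have hctr : ∀ i, CtrWith (max K₀ 0) (Z i) := fun i =>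
    (hK i).mono ((hK₀ i).trans (le_max_left _ _))
  have hsep : ∀ ij : ι × ι, ∃ B, ij.1 ≠ ij.2 → ∀ x,
      ProjWithin (Z ij.1) o B x ∨ ProjWithin (Z ij.2) o B x := fun ij => by
    by_cases hij : ij.1 = ij.2
    · exact ⟨0, fun h => (h hij).elim⟩
    · obtain ⟨B, hB⟩ := (hZ _ _ hij).exists_projWithin_or (hctr _) (hctr _) o
      exact ⟨B, fun _ => hB⟩
  have hbase : ∀ i, ∃ B, ProjWithin (Z i) o B o := fun i => by
    obtain ⟨p, hp⟩ := IsProj.exists (h i).nonempty o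
    exact ⟨dist o p + max K₀ 0, fun q hq => by
      linarith [dist_triangle o p q, (hctr i).dist_le hp hq]⟩
  choose B₁ hB₁ using hsep
  choose B₂ hB₂ using hbase
  obtain ⟨M₁, hM₁⟩ := Finite.exists_le B₁
  obtain ⟨M₂, hM₂⟩ := Finite.exists_le B₂
  refine ⟨max K₀ 0, max (max M₁ M₂) 0, fun n => ⟨fun i => (h i).nonempty, hctr,
    fun i => pow_smul_eq (h i).smul_eq n, fun i j hij x => ?_, fun i => ?_,
    le_max_right _ _, le_max_right _ _⟩⟩
  · have : B₁ (i, j) ≤ max (max M₁ M₂) 0 :=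
      (hM₁ (i, j)).trans ((le_max_left _ _).trans (le_max_left _ _))
    exact (hB₁ (i, j) hij x).imp (fun h => h.mono this) fun h => h.mono this
  · exact (hB₂ i).mono ((hM₂ i).trans ((le_max_right _ _).trans (le_max_left _ _)))

theorem exists_forall_le_dist_pow {ι : Type*} [Finite ι] {o : X} {b : ι → G} {Z : ι → Set X}
    (h : ∀ i, IsAxis o (b i) (Z i)) (M : ℝ) :
    ∃ N : ℕ, ∀ n ≥ N, ∀ i, M ≤ dist o (b i ^ n • o) := by
  choose N hN using fun i => (h i).diverge M
  obtain ⟨N₀, hN₀⟩ := Finite.exists_le N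
  exact ⟨N₀, fun n hn i => hN i n ((hN₀ i).trans hn)⟩

theorem IsIndepFamily.failsAtMost {ι : Type*} [Fintype ι] {o : X} {K B : ℝ} {b : ι → G}
    {Z : ι → Set X} (h : IsIndepFamily o K B b Z) (x : X) :
    FailsAtMost 1 fun i => ProjWithin (Z i) o B x :=
  failsAtMost_one fun i j hij => h.sep i j hij x

/-- A coarse line projects away from the base point for at most two members of the family. -/
theorem IsIndepFamily.failsAtMost_line {ι : Type*} [Fintype ι] {o : X} {K B D : ℝ} {b : ι → G}
    {Z : ι → Set X} (h : IsIndepFamily o K B b Z) {y : ℤ → X} (hD : 0 ≤ D)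
    (hy : ∀ i j k, i ≤ j → j ≤ k → dist (y i) (y j) + dist (y j) (y k) ≤ dist (y i) (y k) + D) :
    FailsAtMost 2 fun i => ∀ n, ProjWithin (Z i) o (D + K + 2 * B) (y n) := by
  have hB := h.nonneg
  have hK := h.nonneg'
  -- If `m` projected far from `o`, both legs from `m` to `a` and to `c` would run through its
  -- projection and then back near `o`, contradicting near-alignment.
  have mid : ∀ i a c m, ProjWithin (Z i) o B a → ProjWithin (Z i) o B c →
      dist a m + dist m c ≤ dist a c + D → ProjWithin (Z i) o (D + K + 2 * B) m := by
    intro i a c m ha hc hm p hp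
    by_contra! hlt
    obtain ⟨q, hq⟩ := IsProj.exists (h.nonempty i) a
    obtain ⟨r, hr⟩ := IsProj.exists (h.nonempty i) c
    have hq' := ha q hq
    have hr' := hc r hr
    have e1 := h.ctr i hq hp (by linarith [dist_triangle o q p])
    have e2 := h.ctr i hp hr (by linarith [dist_triangle o r p, dist_comm p r])
    linarith [dist_triangle a q r, dist_triangle4 a q o r, dist_triangle o q p,
      dist_triangle o r p, dist_comm p r, dist_comm o q, dist_triangle a q c,
      dist_triangle q o c, dist_triangle o r c, dist_nonneg (x := p) (y := m),
      dist_nonneg (x := m) (y := p)]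
  have mid' : ∀ i l m n, l ≤ m → m ≤ n → ProjWithin (Z i) o B (y l) →
      ProjWithin (Z i) o B (y n) → ProjWithin (Z i) o (D + K + 2 * B) (y m) :=
    fun i l m n hlm hmn hl hn => mid i _ _ _ hl hn (hy l m n hlm hmn)
  refine failsAtMost_two fun i j k hij hik hjk => ?_
  by_contra! hbad
  obtain ⟨⟨l, hl⟩, ⟨m, hm⟩, n, hn⟩ := hbad
  have other : ∀ i j n, ¬ ProjWithin (Z i) o (D + K + 2 * B) (y n) → i ≠ j →
      ProjWithin (Z j) o B (y n) := fun i j n hb hij =>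
    (h.sep i j hij (y n)).resolve_left fun hg => hb (hg.mono (by linarith))
  have lj := other i j l hl hij
  have lk := other i k l hl hik
  have mi := other j i m hm hij.symm
  have mk := other j k m hm hjk
  have ni := other k i n hn hik.symm
  have nj := other k j n hn hjk.symm
  -- Each bad point is good for the other two axes. The middle one of the three thus lies between
  -- two points good for its own axis.
  rcases le_total l m with h1 | h1 <;> rcases le_total m n with h2 | h2 <;>
    rcases le_total l n with h3 | h3
  · exact hm (mid' j l m n h1 h2 lj nj)
  · exact hm (mid' j l m n h1 h2 lj nj)
  · exact hn (mid' k l n m h3 h2 lk mk)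
  · exact hl (mid' i n l m h3 h1 ni mi)
  · exact hl (mid' i m l n h1 h3 mi ni)
  · exact hn (mid' k m n l h2 h3 mk lk)
  · exact hm (mid' j n m l h2 h1 nj lj)
  · exact hm (mid' j n m l h2 h1 nj lj)

variable [IsIsometricSMul G X]

theorem IsAxis.conj {o : X} {b : G} {Y : Set X} (h : IsAxis o b Y) (t : G) :
    IsAxis o (t * b * t⁻¹) (t • Y) := by
  obtain ⟨K, hK⟩ := h.ctr
  refine ⟨h.nonempty.smul_set, ⟨K, hK.smul t⟩, ?_, fun M => ?_⟩
  · rw [smul_smul, inv_mul_cancel_right, mul_smul, h.smul_eq]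
  · obtain ⟨N, hN⟩ := h.diverge (M + 2 * dist o (t • o))
    refine ⟨N, fun n hn => ?_⟩
    have := hN n hn
    rw [conj_pow, mul_smul, mul_smul]
    have a := dist_triangle4 (t • o) o (t • b ^ n • t⁻¹ • o) (t • b ^ n • o)
    rw [dist_smul t o, dist_smul t, dist_smul (b ^ n), dist_smul_inv t o o] at a
    linarith [dist_comm o (t • o)]

/-- If `Y` and `Z` project to `W` near `o`, and `t` preserves `W` and moves `o` far, then `t Z`
projects boundedly to `Y`. -/
theorem bddProj_smul_of_far {K B : ℝ} {Y Z W : Set X} (hY : CtrWith K Y) (hW : CtrWith K W)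
    (hne : W.Nonempty) {t : G} {o : X} (ht : t • W = W) (hYW : ∀ y ∈ Y, ProjWithin W o B y)
    (hZW : ∀ z ∈ Z, ProjWithin W o B z) (hfar : 2 * B + K < dist o (t • o)) :
    BddProj Y (t • Z) := by
  refine bddProj_of_separated hY hW (bddProj_of_projWithin hYW) hYW ?_
  rintro _ ⟨z, hz, rfl⟩
  obtain ⟨p, hp⟩ := IsProj.exists hne z
  have hp' : IsProj W (t • z) (t • p) := by
    have := (isProj_smul_iff t).2 hp
    rwa [ht] at this
  refine ⟨t • p, hp', ?_⟩
  linarith [hZW z hz p hp, dist_triangle_right o (t • o) (t • p), dist_smul t o p]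

theorem IsAxis.exists_bddProj_pow_smul {o : X} {g : G} {Y Z : Set X} (h : IsAxis o g Y)
    (hZ : ∃ K, CtrWith K Z) (hYZ : BddProj Y Z) : ∃ N : ℕ, ∀ n ≥ N, BddProj Z (g ^ n • Z) := by
  obtain ⟨K, hK⟩ := h.ctr
  obtain ⟨K', hK'⟩ := hZ
  obtain ⟨B, hB⟩ := hYZ.exists_projWithin o
  obtain ⟨N, hN⟩ := h.diverge (2 * B + max K K' + 1)
  exact ⟨N, fun n hn => bddProj_smul_of_far (hK'.mono (le_max_right _ _))
    (hK.mono (le_max_left _ _)) h.nonempty (pow_smul_eq h.smul_eq n) hB hB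
    (by linarith [hN n hn])⟩

theorem pairwise_bddProj_pow_smul {g : G} {Z : Set X} (hZ : ∃ K, CtrWith K Z) {N m : ℕ}
    (h : ∀ n ≥ N, BddProj Z (g ^ n • Z)) (hm : N ≤ m) {i j : ℕ} (hij : i ≠ j) :
    BddProj (g ^ (m * i) • Z) (g ^ (m * j) • Z) := by
  have main : ∀ i j : ℕ, i < j → BddProj (g ^ (m * i) • Z) (g ^ (m * j) • Z) := by
    intro i j hij
    have := (h (m * (j - i)) (hm.trans (Nat.le_mul_of_pos_right m (by lia)))).smul (g ^ (m * i))
    rwa [smul_smul, ← pow_add, ← mul_add, add_tsub_cancel_of_le hij.le] at this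
  obtain ⟨K, hK⟩ := hZ
  rcases lt_or_gt_of_ne hij with hij | hij
  · exact main i j hij
  · exact (main j i hij).symm (hK.smul _) (hK.smul _)

/-- Translating the orbit of `h` by multiples of a large power of `g` separates the copies along the
axis of `g`. -/
theorem HasContractingProperty.exists_axes (hX : IsGeodesicSpace X) {o : X}
    (h : HasContractingProperty G o) : ∃ (b : ℕ → G) (Z : ℕ → Set X),
      (∀ i, IsAxis o (b i) (Z i)) ∧ ∀ i j, i ≠ j → BddProj (Z i) (Z j) := by
  obtain ⟨g, h, hg, hh, R, hR⟩ := h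
  have ag := hg.isAxis hX
  have ah := hh.isAxis hX
  obtain ⟨K, hK⟩ := ag.ctr
  obtain ⟨K', hK'⟩ := ah.ctr
  obtain ⟨N, hN⟩ := ag.exists_bddProj_pow_smul ah.ctr (bddProj_of_boundedIntersection
    (hK.mono (le_max_left K K')) (hK'.mono (le_max_right K K')) hR)
  exact ⟨fun i => g ^ (N * i) * h * (g ^ (N * i))⁻¹, fun i => g ^ (N * i) • cyclicOrbit o h,
    fun i => ah.conj _, fun i j hij => pairwise_bddProj_pow_smul ah.ctr hN le_rfl hij⟩

end Axes

/-! ### Independent families in one space. -/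

section SingleAction

variable {G : Type*} [Group G] {X : Type*} [MetricSpace X] [MulAction G X] [IsIsometricSMul G X]

theorem IsIndepFamily.isPingPong {ι : Type*} {o : X} {K B : ℝ} {b : ι → G} {Z : ι → Set X}
    (h : IsIndepFamily o K B b Z) {i : ι} {t : G} (h1 : ProjWithin (Z i) o B (t • o))
    (h2 : ProjWithin (Z i) o B (t⁻¹ • o)) (ht : K + 2 * B < dist o (t • o))
    (hb : 10 * K + 8 * B + 1 ≤ dist o (b i • o)) :
    IsPingPong (t * b i) o ((b i)⁻¹ • o) (5 * K + 4 * B) (ProjWithin (Z i) o (B + K))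
      (ProjWithin (Z i) ((b i)⁻¹ • o) (B + K)) :=
  isPingPong_mul (h.ctr i) (h.nonempty i) (h.smul_eq i) (h.base i) h1 h2 ht hb

/-- Moving along one axis is invisible on the others. Powers of `c 0` thus qualify as `t` in
ping-pong, which makes the elements of `S` contracting. -/
theorem IsIndepFamily.projWithin_of_far {ι : Type*} {o : X} {K B : ℝ} {b : ι → G}
    {Z : ι → Set X} (h : IsIndepFamily o K B b Z) {i j : ι} (hij : i ≠ j) {t : G}
    (ht : t • Z i = Z i) (hfar : 2 * B < dist o (t • o)) : ProjWithin (Z j) o B (t • o) := by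
  refine (h.sep i j hij (t • o)).resolve_left fun hp => ?_
  obtain ⟨p, hpo⟩ := IsProj.exists (h.nonempty i) o
  have hp' : IsProj (Z i) (t • o) (t • p) := by
    have := (isProj_smul_iff t).2 hpo
    rwa [ht] at this
  linarith [hp _ hp', h.base i p hpo, dist_triangle_right o (t • o) (t • p), dist_smul t o p]

theorem IsCoarseLine.smul {Q : Set X} (h : IsCoarseLine Q) (t : G) : IsCoarseLine (t • Q) := by
  obtain ⟨D, y, rfl, hy⟩ := h
  refine ⟨D, fun n => t • y n, ?_, fun i j k hij hjk => ?_⟩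
  · rw [← Set.image_smul, ← Set.range_comp]
    rfl
  · simpa only [dist_smul] using hy i j k hij hjk

/-- Translates of a coarse line project near the base point, for all but two members of the
family, with a uniform bound. -/
theorem IsIndepFamily.exists_failsAtMost_smul {ι : Type*} [Fintype ι] {o : X} {K B : ℝ}
    {b : ι → G} {Z : ι → Set X} (h : IsIndepFamily o K B b Z) {Q : Set X} (hQ : IsCoarseLine Q) :
    ∃ C, ∀ t : G, FailsAtMost 2 fun i => ∀ z ∈ t • Q, ProjWithin (Z i) o C z := by
  obtain ⟨D, y, rfl, hy⟩ := hQ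
  have hD : 0 ≤ D := by
    have := hy 0 0 0 le_rfl le_rfl
    rw [dist_self] at this
    linarith
  refine ⟨D + K + 2 * B, fun t => ?_⟩
  have := h.failsAtMost_line (y := fun n => t • y n) hD fun i j k hij hjk => by
    simpa only [dist_smul] using hy i j k hij hjk
  refine le_trans (Finset.card_le_card fun i hi => ?_) this
  simp only [Finset.mem_filter, Finset.mem_univ, true_and] at hi ⊢
  refine fun hall => hi ?_
  rintro _ ⟨_, ⟨n, rfl⟩, rfl⟩
  exact hall n

end SingleAction

/-! ### Elements and axes common to both spaces. -/

section TwoActions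

variable {G : Type*} [Group G] {X₁ X₂ : Type*} [MetricSpace X₁] [MetricSpace X₂]
  [MulAction G X₁] [MulAction G X₂] [IsIsometricSMul G X₁] [IsIsometricSMul G X₂]

/-- If neither power works alone, then in each space one factor moves the basepoint by at least `2 *
M` and the other by less than `M`, so the product works. -/
theorem exists_le_dist_smul_both {o₁ : X₁} {o₂ : X₂} {g₁ g₂ : G} {Y₁ : Set X₁} {Y₂ : Set X₂}
    (h₁ : IsAxis o₁ g₁ Y₁) (h₂ : IsAxis o₂ g₂ Y₂) (M : ℝ) :
    ∃ x : G, M ≤ dist o₁ (x • o₁) ∧ M ≤ dist o₂ (x • o₂) := by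
  obtain ⟨N₁, hN₁⟩ := h₁.diverge (max M (2 * M))
  obtain ⟨N₂, hN₂⟩ := h₂.diverge (max M (2 * M))
  have a := hN₁ N₁ le_rfl
  have b := hN₂ N₂ le_rfl
  by_cases hd : M ≤ dist o₂ (g₁ ^ N₁ • o₂)
  · exact ⟨_, (le_max_left _ _).trans a, hd⟩
  by_cases hd' : M ≤ dist o₁ (g₂ ^ N₂ • o₁)
  · exact ⟨_, hd', (le_max_left _ _).trans b⟩
  push Not at hd hd'
  refine ⟨g₁ ^ N₁ * g₂ ^ N₂, ?_, ?_⟩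
  · rw [mul_smul]
    have := dist_triangle_right o₁ (g₁ ^ N₁ • o₁) (g₁ ^ N₁ • g₂ ^ N₂ • o₁)
    rw [dist_smul] at this
    linarith [le_max_right M (2 * M)]
  · rw [mul_smul]
    have t := dist_triangle_left (g₁ ^ N₁ • o₂) (g₁ ^ N₁ • g₂ ^ N₂ • o₂) o₂
    rw [dist_smul] at t
    linarith [le_max_right M (2 * M)]

/-- There is an element with a contracting axis in both spaces. -/
theorem exists_common_axis (hX₁ : IsGeodesicSpace X₁) (hX₂ : IsGeodesicSpace X₂) {o₁ : X₁}
    {o₂ : X₂} (h₁ : HasContractingProperty G o₁) (h₂ : HasContractingProperty G o₂) :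
    ∃ (w : G) (Y₁ : Set X₁) (Y₂ : Set X₂), IsAxis o₁ w Y₁ ∧ IsAxis o₂ w Y₂ ∧
      IsCoarseLine Y₁ ∧ IsCoarseLine Y₂ := by
  obtain ⟨b₁, Z₁, hb₁, hZ₁⟩ := h₁.exists_axes hX₁
  obtain ⟨b₂, Z₂, hb₂, hZ₂⟩ := h₂.exists_axes hX₂
  obtain ⟨K₁, B₁, hF₁⟩ := exists_isIndepFamily (ι := Fin 5) (fun i => hb₁ i)
    fun i j hij => hZ₁ i j (Fin.val_injective.ne hij)
  obtain ⟨K₂, B₂, hF₂⟩ := exists_isIndepFamily (ι := Fin 5) (fun i => hb₂ i)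
    fun i j hij => hZ₂ i j (Fin.val_injective.ne hij)
  obtain ⟨N₁, hN₁⟩ := exists_forall_le_dist_pow (fun i : Fin 5 => hb₁ i) (10 * K₁ + 8 * B₁ + 1)
  obtain ⟨N₂, hN₂⟩ := exists_forall_le_dist_pow (fun i : Fin 5 => hb₂ i) (10 * K₂ + 8 * B₂ + 1)
  replace hF₁ := hF₁ N₁
  replace hF₂ := hF₂ N₂
  replace hN₁ := hN₁ N₁ le_rfl
  replace hN₂ := hN₂ N₂ le_rfl
  set c₁ : Fin 5 → G := fun i => b₁ i ^ N₁
  set c₂ : Fin 5 → G := fun i => b₂ i ^ N₂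
  obtain ⟨M₁, hM₁⟩ := Finite.exists_le fun j => dist o₁ (c₂ j • o₁)
  obtain ⟨M₂, hM₂⟩ := Finite.exists_le fun i => dist o₂ (c₁ i • o₂)
  obtain ⟨x, hx₁, hx₂⟩ := exists_le_dist_smul_both (hb₁ 0) (hb₂ 0)
    (max (K₁ + 2 * B₁ + 1 + M₁) (K₂ + 2 * B₂ + 1 + M₂))
  -- The candidate is `c₂ j * x * c₁ i`: in `X₁` it is `t * c₁ i` with `t = c₂ j * x`, and in `X₂`
  -- it is conjugate to `t * c₂ j` with `t = x * c₁ i`. The count is 2 · 5 + 2 · 5 < 25.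
  obtain ⟨i, j, ⟨h1, h2⟩, h3, h4⟩ := FailsAtMost.exists_pair
    (P := fun i j => ProjWithin (Z₁ (i : Fin 5)) o₁ B₁ ((c₂ j * x) • o₁) ∧
      ProjWithin (Z₁ i) o₁ B₁ ((c₂ j * x)⁻¹ • o₁))
    (Q := fun i j => ProjWithin (Z₂ (j : Fin 5)) o₂ B₂ ((x * c₁ i) • o₂) ∧
      ProjWithin (Z₂ j) o₂ B₂ ((x * c₁ i)⁻¹ • o₂))
    (fun j => (hF₁.failsAtMost _).and (hF₁.failsAtMost _))
    (fun i => (hF₂.failsAtMost _).and (hF₂.failsAtMost _)) (by simp)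
  have p₁ := hF₁.isPingPong h1 h2 (by
    have := dist_triangle_left (c₂ j • o₁) (c₂ j • x • o₁) o₁
    rw [dist_smul] at this
    rw [mul_smul]
    linarith [hM₁ j, le_max_left (K₁ + 2 * B₁ + 1 + M₁) (K₂ + 2 * B₂ + 1 + M₂)]) (hN₁ i)
  have p₂ := hF₂.isPingPong h3 h4 (by
    have := dist_triangle o₂ (x • c₁ i • o₂) (x • o₂)
    rw [dist_smul, dist_comm _ o₂] at this
    rw [mul_smul]
    linarith [hM₂ i, le_max_right (K₁ + 2 * B₁ + 1 + M₁) (K₂ + 2 * B₂ + 1 + M₂)]) (hN₂ j)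
  have a₂ := ((p₂.isContractingElement hX₂).isAxis hX₂).conj (c₂ j)
  rw [show c₂ j * (x * c₁ i * c₂ j) * (c₂ j)⁻¹ = c₂ j * x * c₁ i by group] at a₂
  exact ⟨_, _, _, (p₁.isContractingElement hX₁).isAxis hX₁, a₂, p₁.isCoarseLine,
    p₂.isCoarseLine.smul _⟩

/-- There is an element moving two given coarse lines to independent ones. -/
theorem exists_bddProj_smul_both (hX₁ : IsGeodesicSpace X₁) (hX₂ : IsGeodesicSpace X₂) {o₁ : X₁}
    {o₂ : X₂} (h₁ : HasContractingProperty G o₁) (h₂ : HasContractingProperty G o₂)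
    {Y₁ : Set X₁} {Y₂ : Set X₂} (hY₁ : ∃ K, CtrWith K Y₁) (hY₂ : ∃ K, CtrWith K Y₂)
    (l₁ : IsCoarseLine Y₁) (l₂ : IsCoarseLine Y₂) :
    ∃ t : G, BddProj Y₁ (t • Y₁) ∧ BddProj Y₂ (t • Y₂) := by
  obtain ⟨b₁, Z₁, hb₁, hZ₁⟩ := h₁.exists_axes hX₁
  obtain ⟨b₂, Z₂, hb₂, hZ₂⟩ := h₂.exists_axes hX₂
  obtain ⟨K₁, B₁, hF₁⟩ := exists_isIndepFamily (ι := Fin 9) (fun i => hb₁ i)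
    fun i j hij => hZ₁ i j (Fin.val_injective.ne hij)
  obtain ⟨K₂, B₂, hF₂⟩ := exists_isIndepFamily (ι := Fin 9) (fun i => hb₂ i)
    fun i j hij => hZ₂ i j (Fin.val_injective.ne hij)
  -- The bound concerns only the sets `Z₁ i`, so exponent 1 serves to extract it before `N₁` is
  -- chosen.
  obtain ⟨C₁, hC₁⟩ := (hF₁ 1).exists_failsAtMost_smul l₁
  obtain ⟨C₂, hC₂⟩ := (hF₂ 1).exists_failsAtMost_smul l₂
  obtain ⟨D₁, hD₁⟩ := hY₁
  obtain ⟨D₂, hD₂⟩ := hY₂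
  obtain ⟨N₁, hN₁⟩ := exists_forall_le_dist_pow (fun i : Fin 9 => hb₁ i)
    (2 * C₁ + max K₁ D₁ + 1)
  obtain ⟨N₂, hN₂⟩ := exists_forall_le_dist_pow (fun i : Fin 9 => hb₂ i)
    (2 * C₂ + max K₂ D₂ + 1)
  replace hF₁ := hF₁ N₁
  replace hF₂ := hF₂ N₂
  replace hN₁ := hN₁ N₁ le_rfl
  replace hN₂ := hN₂ N₂ le_rfl
  set c₁ : Fin 9 → G := fun i => b₁ i ^ N₁
  set c₂ : Fin 9 → G := fun i => b₂ i ^ N₂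
  -- In `X₁`, `c₁ i` pushes `c₂ j • Y₁` away from `Y₁`. In `X₂`, `(c₂ j)⁻¹` pushes `(c₁ i)⁻¹ • Y₂`
  -- away from `Y₂`, and translating by `c₁ i * c₂ j` gives the claim. The count is 4 · 9 + 4 · 9 <
  -- 81.
  obtain ⟨i, j, ⟨h1, h2⟩, h3, h4⟩ := FailsAtMost.exists_pair
    (P := fun i j => (∀ z ∈ (1 : G) • Y₁, ProjWithin (Z₁ (i : Fin 9)) o₁ C₁ z) ∧
      ∀ z ∈ c₂ j • Y₁, ProjWithin (Z₁ i) o₁ C₁ z)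
    (Q := fun i j => (∀ z ∈ (1 : G) • Y₂, ProjWithin (Z₂ (j : Fin 9)) o₂ C₂ z) ∧
      ∀ z ∈ (c₁ i)⁻¹ • Y₂, ProjWithin (Z₂ j) o₂ C₂ z)
    (fun j => (hC₁ 1).and (hC₁ _)) (fun i => (hC₂ 1).and (hC₂ _)) (by simp)
  rw [one_smul] at h1 h3
  have r₁ := bddProj_smul_of_far (hD₁.mono (le_max_right K₁ D₁))
    ((hF₁.ctr i).mono (le_max_left K₁ D₁)) (hF₁.nonempty i) (hF₁.smul_eq i) h1 h2
    (by linarith [hN₁ i])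
  have r₂ := bddProj_smul_of_far (t := (c₂ j)⁻¹) (hD₂.mono (le_max_right K₂ D₂))
    ((hF₂.ctr j).mono (le_max_left K₂ D₂)) (hF₂.nonempty j)
    (by rw [inv_smul_eq_iff]; exact (hF₂.smul_eq j).symm) h3 h4
    (by
      rw [dist_comm, dist_smul_inv]
      linarith [hN₂ j])
  refine ⟨c₁ i * c₂ j, by rwa [mul_smul], ?_⟩
  have := r₂.smul (c₁ i * c₂ j)
  rw [smul_smul, smul_smul, mul_inv_cancel_right, mul_inv_cancel, one_smul] at this
  exact this.symm (hD₂.smul _) hD₂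

/-- There are infinitely many elements whose axes are pairwise independent in both spaces. -/
theorem exists_common_axes (hX₁ : IsGeodesicSpace X₁) (hX₂ : IsGeodesicSpace X₂) {o₁ : X₁}
    {o₂ : X₂} (h₁ : HasContractingProperty G o₁) (h₂ : HasContractingProperty G o₂) :
    ∃ (b : ℕ → G) (Y₁ : ℕ → Set X₁) (Y₂ : ℕ → Set X₂),
      (∀ i, IsAxis o₁ (b i) (Y₁ i)) ∧ (∀ i, IsAxis o₂ (b i) (Y₂ i)) ∧
      (∀ i j, i ≠ j → BddProj (Y₁ i) (Y₁ j)) ∧ ∀ i j, i ≠ j → BddProj (Y₂ i) (Y₂ j) := by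
  obtain ⟨w, Y₁, Y₂, a₁, a₂, l₁, l₂⟩ := exists_common_axis hX₁ hX₂ h₁ h₂
  obtain ⟨t, ht₁, ht₂⟩ := exists_bddProj_smul_both hX₁ hX₂ h₁ h₂ a₁.ctr a₂.ctr l₁ l₂
  have c₁ := a₁.conj t
  have c₂ := a₂.conj t
  obtain ⟨N₁, hN₁⟩ := a₁.exists_bddProj_pow_smul c₁.ctr ht₁
  obtain ⟨N₂, hN₂⟩ := a₂.exists_bddProj_pow_smul c₂.ctr ht₂
  set m := max N₁ N₂
  exact ⟨fun i => w ^ (m * i) * (t * w * t⁻¹) * (w ^ (m * i))⁻¹,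
    fun i => w ^ (m * i) • t • Y₁, fun i => w ^ (m * i) • t • Y₂,
    fun i => c₁.conj _, fun i => c₂.conj _,
    fun i j hij => pairwise_bddProj_pow_smul c₁.ctr hN₁ (le_max_left _ _) hij,
    fun i j hij => pairwise_bddProj_pow_smul c₂.ctr hN₂ (le_max_right _ _) hij⟩

/-- The points `g b ^ k o` and `g b ^ l o` are more than `2 * L` apart, so they cannot both be
within `L` of `o`. -/
theorem dist_smul_or_of_far {X : Type*} [MetricSpace X] [MulAction G X] [IsIsometricSMul G X]
    {o : X} {L : ℝ} {b : G} (h : ∀ n : ℕ, 1 ≤ n → 2 * L < dist o (b ^ n • o)) (g : G) {k l : ℕ}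
    (hkl : k ≠ l) : L < dist o ((g * b ^ k) • o) ∨ L < dist o ((g * b ^ l) • o) := by
  by_contra! hd
  have t := dist_triangle_left ((g * b ^ k) • o) ((g * b ^ l) • o) o
  rw [mul_smul, mul_smul, dist_smul, ← zpow_natCast, ← zpow_natCast,
    IsPingPong.dist_zpow_eq_natAbs] at t
  have := h ((k : ℤ) - l).natAbs (by lia)
  rw [mul_smul, mul_smul] at hd
  simp only [zpow_natCast] at t
  linarith [hd.1, hd.2]

end TwoActions

/-! ### The main theorem. -/

theorem mainTheorem3 {G : Type*} [Group G] {X₁ X₂ : Type*} [MetricSpace X₁] [MetricSpace X₂]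
    [MulAction G X₁] [MulAction G X₂] [IsIsometricSMul G X₁] [IsIsometricSMul G X₂]
    (hX₁ : IsGeodesicSpace X₁) (hX₂ : IsGeodesicSpace X₂) (o₁ : X₁) (o₂ : X₂)
    (h₁ : HasContractingProperty G o₁) (h₂ : HasContractingProperty G o₂) :
    ∃ (ε : ℝ) (S : Finset G), 0 < ε ∧ S.card ≤ 15 ∧
      (S : Set G) ⊆ simultaneouslyContracting G o₁ o₂ ∧
      ∀ g : G, ∃ f ∈ S,
        dist o₁ ((g * f) • o₁) - 2 * ε ≤ stableLength o₁ (g * f) ∧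
        dist o₂ ((g * f) • o₂) - 2 * ε ≤ stableLength o₂ (g * f) ∧
        g * f ∈ simultaneouslyContracting G o₁ o₂ ∧
        f * g ∈ simultaneouslyContracting G o₁ o₂ := by
  classical
  obtain ⟨b, Y₁, Y₂, a₁, a₂, i₁, i₂⟩ := exists_common_axes hX₁ hX₂ h₁ h₂
  obtain ⟨K₁, B₁, hF₁⟩ := exists_isIndepFamily (ι := Fin 6) (fun i => a₁ i)
    fun i j hij => i₁ i j (Fin.val_injective.ne hij)
  obtain ⟨K₂, B₂, hF₂⟩ := exists_isIndepFamily (ι := Fin 6) (fun i => a₂ i)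
    fun i j hij => i₂ i j (Fin.val_injective.ne hij)
  obtain ⟨N₁, hN₁⟩ := exists_forall_le_dist_pow (fun i : Fin 6 => a₁ i) (10 * K₁ + 8 * B₁ + 1)
  obtain ⟨N₂, hN₂⟩ := exists_forall_le_dist_pow (fun i : Fin 6 => a₂ i) (10 * K₂ + 8 * B₂ + 1)
  set N := max (max N₁ N₂) 1 with hN
  have hNle : ∀ n : ℕ, 1 ≤ n → N₁ ≤ N * n ∧ N₂ ≤ N * n := fun n hn => by
    have := Nat.le_mul_of_pos_right N hn
    lia
  replace hF₁ := hF₁ N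
  replace hF₂ := hF₂ N
  set c : Fin 6 → G := fun i => b i ^ N
  have hc₁ : ∀ i (n : ℕ), 1 ≤ n → 10 * K₁ + 8 * B₁ + 1 ≤ dist o₁ (c i ^ n • o₁) :=
    fun i n hn => by rw [← pow_mul]; exact hN₁ _ (hNle n hn).1 i
  have hc₂ : ∀ i (n : ℕ), 1 ≤ n → 10 * K₂ + 8 * B₂ + 1 ≤ dist o₂ (c i ^ n • o₂) :=
    fun i n hn => by rw [← pow_mul]; exact hN₂ _ (hNle n hn).2 i
  have hK₁ := hF₁.nonneg'
  have hK₂ := hF₂.nonneg'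
  have hB₁ := hF₁.nonneg
  have hB₂ := hF₂.nonneg
  have pp₁ : ∀ (t : G) (j : Fin 5), ProjWithin (Y₁ j.succ) o₁ B₁ (t • o₁) →
      ProjWithin (Y₁ j.succ) o₁ B₁ (t⁻¹ • o₁) → K₁ + 2 * B₁ < dist o₁ (t • o₁) → _ :=
    fun t j h1 h2 ht => hF₁.isPingPong h1 h2 ht (by simpa using hc₁ j.succ 1 le_rfl)
  have pp₂ : ∀ (t : G) (j : Fin 5), ProjWithin (Y₂ j.succ) o₂ B₂ (t • o₂) →
      ProjWithin (Y₂ j.succ) o₂ B₂ (t⁻¹ • o₂) → K₂ + 2 * B₂ < dist o₂ (t • o₂) → _ :=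
    fun t j h1 h2 ht => hF₂.isPingPong h1 h2 ht (by simpa using hc₂ j.succ 1 le_rfl)
  -- `ε` dominates the ping-pong losses of both spaces. Axis 0 supplies displacement, the five
  -- others ping-pong.
  refine ⟨5 * K₁ + 4 * B₁ + (5 * K₂ + 4 * B₂) + 1,
    Finset.univ.image fun kj : Fin 3 × Fin 5 => c 0 ^ ((kj.1 : ℕ) + 1) * c kj.2.succ,
    by linarith, Finset.card_image_le.trans (by simp), ?_, fun g => ?_⟩
  · intro f hf
    simp only [Finset.coe_image, Finset.coe_univ, Set.image_univ, Set.mem_range] at hf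
    obtain ⟨⟨k, j⟩, rfl⟩ := hf
    have e₁ := pow_smul_eq (hF₁.smul_eq 0) (k + 1)
    have e₂ := pow_smul_eq (hF₂.smul_eq 0) (k + 1)
    have d₁ := hc₁ 0 (k + 1) (by lia)
    have d₂ := hc₂ 0 (k + 1) (by lia)
    have hj : (0 : Fin 6) ≠ j.succ := (Fin.succ_ne_zero j).symm
    refine ⟨(pp₁ (c 0 ^ ((k : ℕ) + 1)) j ?_ ?_ (by linarith)).isContractingElement hX₁,
      (pp₂ (c 0 ^ ((k : ℕ) + 1)) j ?_ ?_ (by linarith)).isContractingElement hX₂⟩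
    · exact hF₁.projWithin_of_far hj e₁ (by linarith)
    · exact hF₁.projWithin_of_far hj (by rw [inv_smul_eq_iff, e₁])
        (by rw [dist_comm, dist_smul_inv]; linarith)
    · exact hF₂.projWithin_of_far hj e₂ (by linarith)
    · exact hF₂.projWithin_of_far hj (by rw [inv_smul_eq_iff, e₂])
        (by rw [dist_comm, dist_smul_inv]; linarith)
  · have k₁ : FailsAtMost 1 fun k : Fin 3 =>
        K₁ + 2 * B₁ < dist o₁ ((g * c 0 ^ ((k : ℕ) + 1)) • o₁) := failsAtMost_one fun k l hkl =>
      dist_smul_or_of_far (fun n hn => by linarith [hc₁ 0 n hn]) g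
        (by simpa using Fin.val_injective.ne hkl)
    have k₂ : FailsAtMost 1 fun k : Fin 3 =>
        K₂ + 2 * B₂ < dist o₂ ((g * c 0 ^ ((k : ℕ) + 1)) • o₂) := failsAtMost_one fun k l hkl =>
      dist_smul_or_of_far (fun n hn => by linarith [hc₂ 0 n hn]) g
        (by simpa using Fin.val_injective.ne hkl)
    obtain ⟨k, hk₁, hk₂⟩ := (k₁.and k₂).exists (by simp)
    set t := g * c 0 ^ ((k : ℕ) + 1) with ht
    have j₁ : ∀ x, FailsAtMost 1 fun j : Fin 5 => ProjWithin (Y₁ j.succ) o₁ B₁ x := fun x =>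
      failsAtMost_one fun i j hij => hF₁.sep i.succ j.succ ((Fin.succ_injective 5).ne hij) x
    have j₂ : ∀ x, FailsAtMost 1 fun j : Fin 5 => ProjWithin (Y₂ j.succ) o₂ B₂ x := fun x =>
      failsAtMost_one fun i j hij => hF₂.sep i.succ j.succ ((Fin.succ_injective 5).ne hij) x
    -- Four points, each bad for at most one of five axes.
    obtain ⟨j, ⟨h1, h2⟩, h3, h4⟩ := (((j₁ (t • o₁)).and (j₁ (t⁻¹ • o₁))).and
      ((j₂ (t • o₂)).and (j₂ (t⁻¹ • o₂)))).exists (by simp)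
    have p₁ := pp₁ t j h1 h2 hk₁
    have p₂ := pp₂ t j h3 h4 hk₂
    set f := c 0 ^ ((k : ℕ) + 1) * c j.succ with hf
    have e : t * c j.succ = g * f := mul_assoc _ _ _
    have e' : f * g = f * (g * f) * f⁻¹ := by group
    rw [e] at p₁ p₂
    have q₁ := p₁.isContractingElement hX₁
    have q₂ := p₂.isContractingElement hX₂
    refine ⟨f, Finset.mem_image.2 ⟨(k, j), Finset.mem_univ _, rfl⟩, ?_, ?_, ⟨q₁, q₂⟩, ?_⟩
    · linarith [p₁.dist_sub_le_stableLength]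
    · linarith [p₂.dist_sub_le_stableLength]
    · rw [e']
      exact ⟨q₁.conj hX₁ f, q₂.conj hX₂ f⟩
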